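/- Let $n,m,p\ge 1$, let $x_1,\dots,x_n\in\mathbb R^p$ be unit vectors, pairwise non-parallel ($x_i\nparallel x_j$ for $i\ne j$), and let $y_1,\dots,y_n\in\mathbb R$ with $|y_i|<B$. Let $\sigma(z)=\max\{z,0\}$, and for $W=(w_1,\dots,w_m)\in(\mathbb R^p)^m$ and $a\in\mathbb R^m$ put $$f(W,a,x)=\frac1{\sqrt m}\sum_{r=1}^m a_r\,\sigma(w_r^\top x),\qquad L(W,a)=\frac12\sum_{i=1}^n\bigl(f(W,a,x_i)-y_i\bigr)^2 .$$ Let $\lambda_0$ be the smallest eigenvalue of the matrix $H^\infty\in\mathbb R^{n\times n}$ with entries $H^\infty_{ij}=\mathbb E_{w\sim N(0,I)}\bigl[x_i^\top x_j\,\mathbb I\{w^\top x_i\ge 0,\ w^\top x_j\ge 0\}\bigr]$ (for such data $\lambda_0>0$). **Theorem.** Let $\gamma>6$ and $4<\alpha\le 2\gamma/3$. There is a constant $C=C(\alpha,\gamma)>0$, and for every $B$ a constant $K=K(\alpha,\gamma,B)>0$, such that for all data as above, all $\delta\in(0,1)$ and all widths $$m\ \ge\ K\,\frac{n^{5\alpha/2-4}}{\delta^{3\alpha/2-3}\,\lambda_0^{3\alpha/2-2}}$$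 the following holds. Let $w_r(0)\sim N(0,I)$ and $a_r\sim\mathrm{unif}\{-1,1\}$, $r=1,\dots,m$, be independent. Then, with probability at least $1-\delta$ over the initialization, every solution $W:[0,\infty)\to(\mathbb R^p)^m$ of the Nesterov ODE (with $a$ fixed) $$\ddot w_r(t)+\frac{\gamma}{t}\,\dot w_r(t)+\frac{\partial L(W(t),a)}{\partial w_r}=0\quad(r=1,\dots,m),\qquad \dot w_r(0)=0,$$ started at $W(0)$, satisfies, for all $t>0$, $$L(W(t),a)\ \le\ A(\alpha,\gamma,\lambda_0)\;t^{-\alpha}\;L(W(0),a),\qquad A(\alpha,\gamma,\lambda_0)=\frac{C(\alpha,\gamma)}{(\lambda_0/2)^{\alpha/2}} .$$ Here $\frac{\partial L}{\partial w_r}=\sum_i (f(W,a,x_i)-y_i)\,\frac{1}{\sqrt m}\,a_r\,\sigma'(w_r^\top x_i)\,x_i$ with $\sigma'(z)=1$ for $z>0$, $\sigma'(z)=0$ for $z<0$ and $\sigma'(0)$ any value in $[0,1]$; a solution is a continuously differentiable $W$ whose velocity is locally absolutely continuous on $(0,\infty)$ and which satisfies the equation for almost every $t>0$. -/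

import Mathlib

open MeasureTheory ProbabilityTheory
open scoped RealInnerProductSpace

/-- The ReLU activation. -/
noncomputable def relu (z : ℝ) : ℝ := max z 0

/-- The admissible values of `σ'(z)` for the ReLU `σ`: `1` if `z > 0`, `0` if `z < 0`, and any number
of `[0, 1]` at the kink `z = 0`.  In particular both conventions `σ'(z) = 𝕀(z ≥ 0)` and
`σ'(z) = 𝕀(z > 0)` are covered. -/
def reluSlope (z : ℝ) : Set ℝ := {s | (0 < z → s = 1) ∧ (z < 0 → s = 0) ∧ 0 ≤ s ∧ s ≤ 1}

/-- The two-layer network `f(W, a, x) = m^{-1/2} ∑ᵣ aᵣ σ(wᵣᵀ x)`. -/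
noncomputable def network {m p : ℕ} (W : Fin m → EuclideanSpace ℝ (Fin p)) (a : Fin m → ℝ)
    (x : EuclideanSpace ℝ (Fin p)) : ℝ :=
  1 / √(m : ℝ) * ∑ r, a r * relu ⟪W r, x⟫

/-- The squared loss `L(W, a) = ½ ∑ᵢ (f(W, a, xᵢ) - yᵢ)²` on the training set `(xᵢ, yᵢ)`. -/
noncomputable def loss {n m p : ℕ} (x : Fin n → EuclideanSpace ℝ (Fin p)) (y : Fin n → ℝ)
    (W : Fin m → EuclideanSpace ℝ (Fin p)) (a : Fin m → ℝ) : ℝ :=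
  1 / 2 * ∑ i, (network W a (x i) - y i) ^ 2

/-- `g` is a value of the gradient `(∂L/∂wᵣ)ᵣ` at `W`:
`∂L/∂wᵣ = ∑ᵢ (fᵢ - yᵢ) ∂fᵢ/∂wᵣ` with `∂fᵢ/∂wᵣ = m^{-1/2} aᵣ σ'(wᵣᵀ xᵢ) xᵢ`. -/
def IsLossGradient {n m p : ℕ} (x : Fin n → EuclideanSpace ℝ (Fin p)) (y : Fin n → ℝ)
    (W : Fin m → EuclideanSpace ℝ (Fin p)) (a : Fin m → ℝ)
    (g : Fin m → EuclideanSpace ℝ (Fin p)) : Prop :=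
  ∃ s : Fin m → Fin n → ℝ, (∀ r i, s r i ∈ reluSlope ⟪W r, x i⟫) ∧
    ∀ r, g r = ∑ i, ((network W a (x i) - y i) * (1 / √(m : ℝ) * a r * s r i)) • x i

/-- `W : [0, ∞) → (ℝᵖ)ᵐ` is a solution of the Nesterov flow
`ẅᵣ(t) + (γ / t) ẇᵣ(t) + ∂L/∂wᵣ = 0`, `W(0) = W₀`, `Ẇ(0) = 0`.  As `∂L/∂wᵣ` is discontinuous, this is
meant in the Carathéodory sense: `W` is continuously differentiable with velocity `V`, the velocity
is locally absolutely continuous on `(0, ∞)`, and the equation holds for almost every `t > 0`. -/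
structure IsNesterovFlow {n m p : ℕ} (γ : ℝ) (x : Fin n → EuclideanSpace ℝ (Fin p))
    (y : Fin n → ℝ) (a : Fin m → ℝ) (W₀ : Fin m → EuclideanSpace ℝ (Fin p))
    (W V : ℝ → Fin m → EuclideanSpace ℝ (Fin p)) : Prop where
  init_pos : W 0 = W₀
  init_vel : V 0 = 0
  hasDeriv : ∀ r, ∀ t, 0 ≤ t →
    HasDerivWithinAt (fun τ => W τ r) (V t r) (Set.Ici 0) t
  continuous_vel : ∀ r, ContinuousOn (fun τ => V τ r) (Set.Ici 0)
  absCont_vel : ∀ r, ∀ t₁ t₂, 0 < t₁ → t₁ ≤ t₂ →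
    AbsolutelyContinuousOnInterval (fun τ => V τ r) t₁ t₂
  equation : ∀ᵐ t ∂(volume.restrict (Set.Ioi (0 : ℝ))), ∃ g, IsLossGradient x y (W t) a g ∧
    ∀ r, HasDerivAt (fun τ => V τ r) (-((γ / t) • V t r) - g r) t

open Classical in
/-- The limiting Gram matrix
`(H^∞)ᵢⱼ = 𝔼_{w ∼ N(0, I)} [xᵢᵀ xⱼ 𝕀{wᵀ xᵢ ≥ 0, wᵀ xⱼ ≥ 0}]`. -/
noncomputable def gramInfty {n p : ℕ} (x : Fin n → EuclideanSpace ℝ (Fin p)) :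
    Matrix (Fin n) (Fin n) ℝ :=
  Matrix.of fun i j => ∫ w, (if 0 ≤ ⟪w, x i⟫ ∧ 0 ≤ ⟪w, x j⟫ then ⟪x i, x j⟫ else 0)
    ∂(stdGaussian (EuclideanSpace ℝ (Fin p)))

/-- `λ₀`, the smallest eigenvalue of the (symmetric) matrix `H^∞`. -/
noncomputable def lambdaZero {n p : ℕ} (x : Fin n → EuclideanSpace ℝ (Fin p)) : ℝ :=
  sInf (spectrum ℝ (gramInfty x))

/-- The law of the initialization `(W(0), a)`: independent `wᵣ ∼ N(0, I)` and
`aᵣ ∼ unif{-1, 1}`, `r = 1, …, m`. -/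
noncomputable def initLaw (m p : ℕ) :
    Measure ((Fin m → EuclideanSpace ℝ (Fin p)) × (Fin m → ℝ)) :=
  (Measure.pi fun _ : Fin m => stdGaussian (EuclideanSpace ℝ (Fin p))).prod
    (Measure.pi fun _ : Fin m => uniformOn ({-1, 1} : Set ℝ))

section

open Set Filter Topology

/-!
Let `u` be the vector of residuals and `p` the velocity of all neurons. Almost everywhere
`u' = J p` and `p' = -(γ / t) p - Jᵀ u`, where `J` is a Jacobian of the network outputs. While `J`
stays within `√c / 6` of a fixed `J₀` with `J₀ J₀ᵀ ≥ c`, and `t` is at least a multiple of `1 / √c`,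
the function `t ^ α (‖u‖² + ‖p‖²) / 2 + (γ / 2) t ^ (α - 1) ⟪Q u, p⟫`, with
`Q = J₀ᵀ (J₀ J₀ᵀ)⁻¹`, does not increase, and so `‖u‖² = O(t ^ (-α))`.

Each neuron is driven by a force of order `√(n / m) ‖u‖`, and since `α > 4` its total displacement
is at most `R = O(√(n / m) ‖u(0)‖ / c)`. Only gates with `|wᵣᵀ xᵢ| ≤ R` at initialization can change
along the way; for wide networks they are few, so that `J` does stay close to `J₀`. A continuity
argument resolves the circularity, and Markov's inequality shows that random initial weights have
the required properties with `c = λ₀ / 2`.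
-/

section AbsoluteContinuity

theorem absolutelyContinuousOnInterval_of_dist_le_add {X Y Z : Type*} [PseudoMetricSpace X]
    [PseudoMetricSpace Y] [PseudoMetricSpace Z] {f : ℝ → X} {g : ℝ → Y} {φ : ℝ → Z}
    {a b C D : ℝ} (hf : AbsolutelyContinuousOnInterval f a b)
    (hg : AbsolutelyContinuousOnInterval g a b)
    (h : ∀ s ∈ uIcc a b, ∀ t ∈ uIcc a b,
      dist (φ s) (φ t) ≤ C * dist (f s) (f t) + D * dist (g s) (g t)) :
    AbsolutelyContinuousOnInterval φ a b := by
  unfold AbsolutelyContinuousOnInterval at hf hg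
  apply squeeze_zero' ?_ ?_ (by simpa using (hf.const_mul C).add (hg.const_mul D))
  · exact Eventually.of_forall fun _ => Finset.sum_nonneg fun _ _ => dist_nonneg
  rw [eventually_inf_principal]
  filter_upwards with (n, I) hnI
  simp only [Finset.mul_sum, ← Finset.sum_add_distrib]
  exact Finset.sum_le_sum fun i hi => h _ (hnI.1 i hi).1 _ (hnI.1 i hi).2

theorem absolutelyContinuousOnInterval_lipschitzWith_comp {X Z : Type*} [PseudoMetricSpace X]
    [PseudoMetricSpace Z] {f : ℝ → X} {φ : X → Z} {K : NNReal} {a b : ℝ} (hφ : LipschitzWith K φ)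
    (hf : AbsolutelyContinuousOnInterval f a b) :
    AbsolutelyContinuousOnInterval (fun t => φ (f t)) a b :=
  absolutelyContinuousOnInterval_of_dist_le_add (C := K) (D := 0) hf hf fun s _ t _ => by
    simpa using hφ.dist_le_mul (f s) (f t)

theorem absolutelyContinuousOnInterval_inner {E : Type*} [NormedAddCommGroup E]
    [InnerProductSpace ℝ E] {f g : ℝ → E} {a b : ℝ}
    (hf : AbsolutelyContinuousOnInterval f a b) (hg : AbsolutelyContinuousOnInterval g a b) :
    AbsolutelyContinuousOnInterval (fun t => ⟪f t, g t⟫) a b := by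
  obtain ⟨C, hC⟩ := hf.exists_bound
  obtain ⟨D, hD⟩ := hg.exists_bound
  refine absolutelyContinuousOnInterval_of_dist_le_add (C := D) (D := C) hf hg fun s hs t ht => ?_
  simp only [dist_eq_norm]
  calc ‖⟪f s, g s⟫ - ⟪f t, g t⟫‖ = ‖⟪f s - f t, g s⟫ + ⟪f t, g s - g t⟫‖ := by
        rw [inner_sub_left, inner_sub_right, sub_add_sub_cancel]
    _ ≤ ‖f s - f t‖ * ‖g s‖ + ‖f t‖ * ‖g s - g t‖ :=
        (norm_add_le _ _).trans (add_le_add (norm_inner_le_norm _ _) (norm_inner_le_norm _ _))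
    _ ≤ D * ‖f s - f t‖ + C * ‖g s - g t‖ := by
        rw [mul_comm ‖f s - f t‖]
        gcongr
        exacts [hD s hs, hC t ht]

theorem absolutelyContinuousOnInterval_norm_sq {E : Type*} [NormedAddCommGroup E]
    [InnerProductSpace ℝ E] {f : ℝ → E} {a b : ℝ} (hf : AbsolutelyContinuousOnInterval f a b) :
    AbsolutelyContinuousOnInterval (fun t => ‖f t‖ ^ 2) a b := by
  simpa only [real_inner_self_eq_norm_sq] using absolutelyContinuousOnInterval_inner hf hf

theorem absolutelyContinuousOnInterval_pi {ι : Type*} [Fintype ι] {X : ι → Type*}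
    [∀ i, PseudoMetricSpace (X i)] {f : ℝ → ∀ i, X i} {a b : ℝ}
    (hf : ∀ i, AbsolutelyContinuousOnInterval (fun t => f t i) a b) :
    AbsolutelyContinuousOnInterval f a b := by
  unfold AbsolutelyContinuousOnInterval at hf ⊢
  apply squeeze_zero (fun t => ?_) (fun t => ?_)
    (by simpa using tendsto_finsetSum Finset.univ fun i _ => hf i)
  · exact Finset.sum_nonneg fun _ _ => dist_nonneg
  · rw [Finset.sum_comm]
    refine Finset.sum_le_sum fun k _ => ?_
    exact (dist_pi_le_iff (Finset.sum_nonneg fun _ _ => dist_nonneg)).2 fun i =>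
      Finset.single_le_sum (f := fun i => dist (f (t.2 k).1 i) (f (t.2 k).2 i))
        (fun _ _ => dist_nonneg) (Finset.mem_univ i)

theorem absolutelyContinuousOnInterval_toLp {ι : Type*} [Fintype ι] {E : ι → Type*}
    [∀ i, PseudoMetricSpace (E i)] {f : ℝ → ∀ i, E i} {a b : ℝ}
    (hf : ∀ i, AbsolutelyContinuousOnInterval (fun t => f t i) a b) :
    AbsolutelyContinuousOnInterval (fun t => WithLp.toLp 2 (f t)) a b :=
  absolutelyContinuousOnInterval_lipschitzWith_comp (PiLp.lipschitzWith_toLp 2 E)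
    (absolutelyContinuousOnInterval_pi hf)

theorem absolutelyContinuousOnInterval_finset_sum {ι E : Type*} [NormedAddCommGroup E]
    {f : ι → ℝ → E} {a b : ℝ} (s : Finset ι)
    (hf : ∀ i ∈ s, AbsolutelyContinuousOnInterval (f i) a b) :
    AbsolutelyContinuousOnInterval (fun t => ∑ i ∈ s, f i t) a b := by
  classical
  induction s using Finset.induction_on with
  | empty =>
    simpa using (LipschitzWith.const (0 : E)).lipschitzOnWith.absolutelyContinuousOnInterval
  | insert i s hi ih =>
    simp only [Finset.sum_insert hi]
    exact (hf i (Finset.mem_insert_self i s)).fun_add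
      (ih fun j hj => hf j (Finset.mem_insert_of_mem hj))

theorem absolutelyContinuousOnInterval_rpow {a b : ℝ} (ha : 0 < a) (hab : a ≤ b) (s : ℝ) :
    AbsolutelyContinuousOnInterval (fun t : ℝ => t ^ s) a b := by
  apply ContDiffOn.absolutelyContinuousOnInterval
  rw [uIcc_of_le hab]
  exact fun t ht =>
    (Real.contDiffAt_rpow_const_of_ne (ha.trans_le ht.1).ne').contDiffWithinAt

theorem le_of_ae_hasDerivAt_nonpos {f : ℝ → ℝ} {a b : ℝ} (hab : a ≤ b)
    (hf : AbsolutelyContinuousOnInterval f a b)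
    (hf' : ∀ᵐ t, t ∈ Ioo a b → ∃ d ≤ 0, HasDerivAt f d t) : f b ≤ f a := by
  have hint : ∫ t in a..b, deriv f t ≤ 0 := by
    rw [intervalIntegral.integral_of_le hab, ← integral_Ioc_eq_integral_Ioo.symm]
    apply integral_nonpos_of_ae
    rw [EventuallyLE, ae_restrict_iff' measurableSet_Ioo]
    filter_upwards [hf'] with t ht hmem
    obtain ⟨d, hd, hderiv⟩ := ht hmem
    simpa [hderiv.deriv] using hd
  rw [hf.integral_deriv_eq_sub] at hint
  linarith

theorem le_of_tendsto_of_ae_hasDerivAt_nonpos {f : ℝ → ℝ} {a b l : ℝ} (hab : a < b)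
    (hf : ∀ s ∈ Ioo a b, AbsolutelyContinuousOnInterval f s b)
    (hf' : ∀ᵐ t, t ∈ Ioo a b → ∃ d ≤ 0, HasDerivAt f d t)
    (hlim : Tendsto f (𝓝[>] a) (𝓝 l)) : f b ≤ l := by
  refine ge_of_tendsto hlim ?_
  filter_upwards [Ioo_mem_nhdsGT hab] with s hs
  refine le_of_ae_hasDerivAt_nonpos hs.2.le (hf s hs) ?_
  filter_upwards [hf'] with t ht hmem using ht ⟨hs.1.trans hmem.1, hmem.2⟩

end AbsoluteContinuity

section DampedSystem

variable {U X : Type*} [NormedAddCommGroup U] [NormedAddCommGroup X]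

/-- The energy `½ (‖u‖² + ‖p‖²)` of a residual `u` and a velocity `p`. -/
noncomputable def energy (u : ℝ → U) (p : ℝ → X) (t : ℝ) : ℝ := (‖u t‖ ^ 2 + ‖p t‖ ^ 2) / 2

theorem energy_nonneg (u : ℝ → U) (p : ℝ → X) (t : ℝ) : 0 ≤ energy u p t := by
  unfold energy; positivity

variable [InnerProductSpace ℝ U] [InnerProductSpace ℝ X]

theorem absolutelyContinuousOnInterval_energy {u : ℝ → U} {p : ℝ → X} {a b : ℝ}
    (hu : AbsolutelyContinuousOnInterval u a b) (hp : AbsolutelyContinuousOnInterval p a b) :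
    AbsolutelyContinuousOnInterval (energy u p) a b := by
  have henergy : energy u p = fun t => 2⁻¹ * (‖u t‖ ^ 2 + ‖p t‖ ^ 2) :=
    funext fun t => div_eq_inv_mul _ _
  rw [henergy]
  exact ((absolutelyContinuousOnInterval_norm_sq hu).fun_add
    (absolutelyContinuousOnInterval_norm_sq hp)).const_mul 2⁻¹

theorem abs_inner_apply_le_mul_energy {q : ℝ} {Q : U →L[ℝ] X} (hQ : ∀ z, ‖Q z‖ ≤ q * ‖z‖)
    (hq : 0 ≤ q) (u : ℝ → U) (p : ℝ → X) (t : ℝ) : |⟪Q (u t), p t⟫| ≤ q * energy u p t :=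
  calc |⟪Q (u t), p t⟫| ≤ ‖Q (u t)‖ * ‖p t‖ := abs_real_inner_le_norm _ _
    _ ≤ q * ‖u t‖ * ‖p t‖ := by gcongr; exact hQ _
    _ = q * (‖u t‖ * ‖p t‖) := mul_assoc _ _ _
    _ ≤ q * energy u p t := by
      gcongr
      unfold energy
      linarith [two_mul_le_add_sq ‖u t‖ ‖p t‖]

/-- The energy at rate `t ^ α`, corrected by a cross term: along a damped system the derivative of
`⟪Q u, p⟫` supplies the dissipation of `‖u‖²` that the energy lacks. -/
noncomputable def lyapunov (γ α : ℝ) (Q : U →L[ℝ] X) (u : ℝ → U) (p : ℝ → X) (t : ℝ) : ℝ :=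
  t ^ α * energy u p t + γ / 2 * (t ^ (α - 1) * ⟪Q (u t), p t⟫)

theorem absolutelyContinuousOnInterval_lyapunov (γ α : ℝ) (Q : U →L[ℝ] X) {u : ℝ → U}
    {p : ℝ → X} {a b : ℝ} (ha : 0 < a) (hab : a ≤ b) (hu : AbsolutelyContinuousOnInterval u a b)
    (hp : AbsolutelyContinuousOnInterval p a b) :
    AbsolutelyContinuousOnInterval (lyapunov γ α Q u p) a b :=
  ((absolutelyContinuousOnInterval_rpow ha hab α).fun_mul
    (absolutelyContinuousOnInterval_energy hu hp)).fun_add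
  (((absolutelyContinuousOnInterval_rpow ha hab (α - 1)).fun_mul
    (absolutelyContinuousOnInterval_inner
      (absolutelyContinuousOnInterval_lipschitzWith_comp Q.lipschitz hu) hp)).const_mul (γ / 2))

theorem abs_lyapunov_sub_le {γ α q t : ℝ} (hγ : 0 < γ) (hα : 0 < α) (hq : 0 ≤ q) (ht : 0 < t)
    {Q : U →L[ℝ] X} (hQ : ∀ z, ‖Q z‖ ≤ q * ‖z‖) (hqt : 3 * (1 + γ + α) * q ≤ t)
    (u : ℝ → U) (p : ℝ → X) :
    |lyapunov γ α Q u p t - t ^ α * energy u p t| ≤ t ^ α * energy u p t / 6 := by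
  have hcross := abs_inner_apply_le_mul_energy hQ hq u p t
  have hE := energy_nonneg u p t
  have hcoeff : γ / 2 * q ≤ t / 6 := by nlinarith
  rw [lyapunov, add_sub_cancel_left, abs_mul, abs_mul, abs_of_pos (half_pos hγ),
    abs_of_pos (Real.rpow_pos_of_pos ht _), Real.rpow_sub_one ht.ne']
  calc γ / 2 * (t ^ α / t * |⟪Q (u t), p t⟫|)
      ≤ γ / 2 * (t ^ α / t * (q * energy u p t)) := by gcongr
    _ = t ^ α / t * energy u p t * (γ / 2 * q) := by ring
    _ ≤ t ^ α / t * energy u p t * (t / 6) := by gcongr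
    _ = t ^ α * energy u p t / 6 := by field_simp

variable [CompleteSpace U] [CompleteSpace X]

theorem hasDerivAt_energy {γ t : ℝ} {J : X →L[ℝ] U} {u : ℝ → U} {p : ℝ → X}
    (hu : HasDerivAt u (J (p t)) t)
    (hp : HasDerivAt p (-((γ / t) • p t) - J.adjoint (u t)) t) :
    HasDerivAt (energy u p) (-(γ / t) * ‖p t‖ ^ 2) t := by
  refine ((hu.norm_sq.add hp.norm_sq).div_const 2).congr_deriv ?_
  rw [inner_sub_right, inner_neg_right, real_inner_smul_right, real_inner_self_eq_norm_sq,
    J.adjoint_inner_right, real_inner_comm (J (p t))]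
  ring

theorem hasDerivAt_lyapunov (α : ℝ) {γ t : ℝ} (ht : 0 < t) (Q : U →L[ℝ] X) {J : X →L[ℝ] U}
    {u : ℝ → U} {p : ℝ → X} (hu : HasDerivAt u (J (p t)) t)
    (hp : HasDerivAt p (-((γ / t) • p t) - J.adjoint (u t)) t) :
    HasDerivAt (lyapunov γ α Q u p)
      (t ^ α / t * (α * energy u p t - γ * ‖p t‖ ^ 2 +
        γ / 2 * (⟪Q (J (p t)), p t⟫ - ⟪Q (u t), J.adjoint (u t)⟫) +
        γ / 2 * ((α - 1 - γ) * (⟪Q (u t), p t⟫ / t)))) t := by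
  have hcross := (Q.hasFDerivAt.comp_hasDerivAt t hu).inner ℝ hp
  refine (((Real.hasDerivAt_rpow_const (Or.inl ht.ne')).mul (hasDerivAt_energy hu hp)).add
    (((Real.hasDerivAt_rpow_const (p := α - 1) (Or.inl ht.ne')).mul hcross).const_mul
      (γ / 2))).congr_deriv ?_
  simp only [Function.comp_apply, inner_sub_right, inner_neg_right, real_inner_smul_right]
  rw [Real.rpow_sub_one ht.ne' (α - 1), Real.rpow_sub_one ht.ne' α]
  field_simp
  ring

theorem lyapunov_deriv_nonpos {γ α q t : ℝ} (hγ : 0 < γ) (hα : 0 < α) (hαγ : α ≤ 2 * γ / 3)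
    (hq : 0 ≤ q) (ht : 0 < t) {Q : U →L[ℝ] X} (hQ : ∀ z, ‖Q z‖ ≤ q * ‖z‖)
    (hqt : 3 * (1 + γ + α) * q ≤ t) {J : X →L[ℝ] U} (hQJ : ∀ v, ⟪Q (J v), v⟫ ≤ 7 / 6 * ‖v‖ ^ 2)
    (hJQ : ∀ z, 5 / 6 * ‖z‖ ^ 2 ≤ ⟪Q z, J.adjoint z⟫) (u : ℝ → U) (p : ℝ → X) :
    α * energy u p t - γ * ‖p t‖ ^ 2 +
      γ / 2 * (⟪Q (J (p t)), p t⟫ - ⟪Q (u t), J.adjoint (u t)⟫) +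
      γ / 2 * ((α - 1 - γ) * (⟪Q (u t), p t⟫ / t)) ≤ 0 := by
  have hE := energy_nonneg u p t
  have hrate : α * energy u p t ≤ 2 * γ / 3 * energy u p t := by gcongr
  have hdissipation : γ / 2 * (⟪Q (J (p t)), p t⟫ - ⟪Q (u t), J.adjoint (u t)⟫) ≤
      γ / 2 * (7 / 6 * ‖p t‖ ^ 2 - 5 / 6 * ‖u t‖ ^ 2) := by
    gcongr
    exacts [hQJ _, hJQ _]
  have hcross : (α - 1 - γ) * (⟪Q (u t), p t⟫ / t) ≤ energy u p t / 3 :=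
    calc (α - 1 - γ) * (⟪Q (u t), p t⟫ / t) ≤ |α - 1 - γ| * (|⟪Q (u t), p t⟫| / t) := by
          rw [← abs_of_pos ht, ← abs_div, ← abs_mul, abs_of_pos ht]
          exact le_abs_self _
      _ ≤ (1 + γ + α) * (q * energy u p t / t) := by
          gcongr
          · rw [abs_le]; constructor <;> linarith
          · exact abs_inner_apply_le_mul_energy hQ hq u p t
      _ = 3 * (1 + γ + α) * q * (energy u p t / 3 / t) := by ring
      _ ≤ t * (energy u p t / 3 / t) := by gcongr
      _ = energy u p t / 3 := by field_simp
  have hcross' := mul_le_mul_of_nonneg_left hcross (half_pos hγ).le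
  -- At the extreme rate `α = 2 γ / 3` the coefficients of `‖u‖²` and `‖p‖²` both vanish; this
  -- dictates the constants `7 / 6`, `5 / 6` and the time scale `3 (1 + γ + α) q`.
  unfold energy at hrate hcross' ⊢
  linarith

/-- A residual `u` and a velocity `p` evolve on `[0, T]`, from rest, by the damped linear equations
`u' = J p`, `p' = -(γ / t) p - Jᵀ u`, where `J` is allowed to vary in time within the set `𝒥`. -/
structure IsDampedSystem (γ T : ℝ) (𝒥 : Set (X →L[ℝ] U)) (u : ℝ → U) (p : ℝ → X) : Prop where
  continuousOn_residual : ContinuousOn u (Icc 0 T)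
  continuousOn_velocity : ContinuousOn p (Icc 0 T)
  absCont_residual : ∀ a b, 0 < a → a ≤ b → b ≤ T → AbsolutelyContinuousOnInterval u a b
  absCont_velocity : ∀ a b, 0 < a → a ≤ b → b ≤ T → AbsolutelyContinuousOnInterval p a b
  velocity_zero : p 0 = 0
  equation : ∀ᵐ t, t ∈ Ioo 0 T → ∃ J ∈ 𝒥,
    HasDerivAt u (J (p t)) t ∧ HasDerivAt p (-((γ / t) • p t) - J.adjoint (u t)) t

namespace IsDampedSystem

variable {γ T : ℝ} {𝒥 : Set (X →L[ℝ] U)} {u : ℝ → U} {p : ℝ → X}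

theorem energy_le (h : IsDampedSystem γ T 𝒥 u p) (hγ : 0 ≤ γ) {t : ℝ} (ht : t ∈ Icc 0 T) :
    energy u p t ≤ ‖u 0‖ ^ 2 / 2 := by
  have henergy : energy u p 0 = ‖u 0‖ ^ 2 / 2 := by simp [energy, h.velocity_zero]
  rw [← henergy]
  rcases ht.1.eq_or_lt with rfl | ht₀
  · rfl
  have hcont : ContinuousOn (energy u p) (Icc 0 T) :=
    ((h.continuousOn_residual.norm.pow 2).add (h.continuousOn_velocity.norm.pow 2)).div_const 2
  refine le_of_tendsto_of_ae_hasDerivAt_nonpos ht₀ (fun s hs =>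
    absolutelyContinuousOnInterval_energy (h.absCont_residual s t hs.1 hs.2.le ht.2)
      (h.absCont_velocity s t hs.1 hs.2.le ht.2)) ?_ ?_
  · filter_upwards [h.equation] with s hs hmem
    obtain ⟨J, -, hu, hp⟩ := hs ⟨hmem.1, hmem.2.trans_le ht.2⟩
    refine ⟨_, ?_, hasDerivAt_energy hu hp⟩
    have := div_nonneg hγ hmem.1.le
    nlinarith [sq_nonneg ‖p s‖]
  · have h0 := hcont 0 ⟨le_rfl, ht.1.trans ht.2⟩
    rw [ContinuousWithinAt] at h0
    exact h0.mono_left ((nhdsWithin_Ioc_eq_nhdsGT (ht₀.trans_le ht.2)).symm.trans_le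
      (nhdsWithin_mono _ Ioc_subset_Icc_self))

theorem norm_residual_le (h : IsDampedSystem γ T 𝒥 u p) (hγ : 0 ≤ γ) {t : ℝ} (ht : t ∈ Icc 0 T) :
    ‖u t‖ ≤ ‖u 0‖ := by
  have := h.energy_le hγ ht
  unfold energy at this
  exact le_of_sq_le_sq (by linarith [sq_nonneg ‖p t‖]) (norm_nonneg _)

theorem lyapunov_le (h : IsDampedSystem γ T 𝒥 u p) {α q τ t : ℝ} (hγ : 0 < γ) (hα : 0 < α)
    (hαγ : α ≤ 2 * γ / 3) (hq : 0 ≤ q) (hτ : 0 < τ) (hqτ : 3 * (1 + γ + α) * q ≤ τ)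
    {Q : U →L[ℝ] X} (hQ : ∀ z, ‖Q z‖ ≤ q * ‖z‖)
    (hQJ : ∀ J ∈ 𝒥, ∀ v, ⟪Q (J v), v⟫ ≤ 7 / 6 * ‖v‖ ^ 2)
    (hJQ : ∀ J ∈ 𝒥, ∀ z, 5 / 6 * ‖z‖ ^ 2 ≤ ⟪Q z, J.adjoint z⟫) (ht : t ∈ Icc τ T) :
    lyapunov γ α Q u p t ≤ lyapunov γ α Q u p τ := by
  refine le_of_ae_hasDerivAt_nonpos ht.1 (absolutelyContinuousOnInterval_lyapunov γ α Q hτ ht.1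
    (h.absCont_residual τ t hτ ht.1 ht.2) (h.absCont_velocity τ t hτ ht.1 ht.2)) ?_
  filter_upwards [h.equation] with s hs hmem
  have hs₀ : 0 < s := hτ.trans hmem.1
  obtain ⟨J, hJ, hu, hp⟩ := hs ⟨hs₀, hmem.2.trans_le ht.2⟩
  exact ⟨_, mul_nonpos_of_nonneg_of_nonpos (by positivity)
    (lyapunov_deriv_nonpos hγ hα hαγ hq hs₀ hQ (hqτ.trans hmem.1.le) (hQJ J hJ) (hJQ J hJ) u p),
    hasDerivAt_lyapunov α hs₀ Q hu hp⟩

theorem norm_residual_sq_le_of_inner_le (h : IsDampedSystem γ T 𝒥 u p) {α q t : ℝ} (hγ : 0 < γ)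
    (hα : 0 < α) (hαγ : α ≤ 2 * γ / 3) (hq : 0 < q) {Q : U →L[ℝ] X} (hQ : ∀ z, ‖Q z‖ ≤ q * ‖z‖)
    (hQJ : ∀ J ∈ 𝒥, ∀ v, ⟪Q (J v), v⟫ ≤ 7 / 6 * ‖v‖ ^ 2)
    (hJQ : ∀ J ∈ 𝒥, ∀ z, 5 / 6 * ‖z‖ ^ 2 ≤ ⟪Q z, J.adjoint z⟫) (ht : t ∈ Ioc 0 T) :
    ‖u t‖ ^ 2 ≤ 2 * (3 * (1 + γ + α) * q / t) ^ α * ‖u 0‖ ^ 2 := by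
  set τ := 3 * (1 + γ + α) * q
  have hτ : 0 < τ := by positivity
  rcases le_total t τ with htτ | hτt
  · have hdecay : 1 ≤ (τ / t) ^ α := Real.one_le_rpow ((one_le_div ht.1).2 htτ) hα.le
    have hnorm : ‖u t‖ ^ 2 ≤ ‖u 0‖ ^ 2 := by
      gcongr
      exact h.norm_residual_le hγ.le (Ioc_subset_Icc_self ht)
    nlinarith [sq_nonneg ‖u 0‖]
  have hF := h.lyapunov_le hγ hα hαγ hq.le hτ le_rfl hQ hQJ hJQ ⟨hτt, ht.2⟩
  have hFt := (abs_le.1 (abs_lyapunov_sub_le hγ hα hq.le ht.1 hQ hτt u p)).1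
  have hFτ := (abs_le.1 (abs_lyapunov_sub_le hγ hα hq.le hτ hQ le_rfl u p)).2
  have hEτ : τ ^ α * energy u p τ ≤ τ ^ α * (‖u 0‖ ^ 2 / 2) := by
    gcongr
    exact h.energy_le hγ.le ⟨hτ.le, hτt.trans ht.2⟩
  have hEt : t ^ α * (‖u t‖ ^ 2 / 2) ≤ t ^ α * energy u p t := by
    have : 0 ≤ t := ht.1.le
    unfold energy
    gcongr
    linarith [sq_nonneg ‖p t‖]
  have htα : 0 < t ^ α := Real.rpow_pos_of_pos ht.1 _
  have hτα : 0 ≤ τ ^ α * ‖u 0‖ ^ 2 := by positivity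
  rw [Real.div_rpow hτ.le ht.1.le, mul_div_assoc', div_mul_eq_mul_div, le_div_iff₀ htα]
  linarith

end IsDampedSystem

end DampedSystem

section RightInverse

variable {U X : Type*} [NormedAddCommGroup U] [InnerProductSpace ℝ U] [NormedAddCommGroup X]
  [InnerProductSpace ℝ X]

variable {A J : X →L[ℝ] U} {Q : U →L[ℝ] X} {q ε : ℝ}

theorem inner_rightInverse_apply_le (hQ : ∀ z, ‖Q z‖ ≤ q * ‖z‖)
    (hQA : ∀ v, ⟪Q (A v), v⟫ ≤ ‖v‖ ^ 2) (hq : 0 ≤ q) (hJ : q * ‖J - A‖ ≤ ε) (v : X) :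
    ⟪Q (J v), v⟫ ≤ (1 + ε) * ‖v‖ ^ 2 := by
  have herror : ⟪Q ((J - A) v), v⟫ ≤ ε * ‖v‖ ^ 2 :=
    calc ⟪Q ((J - A) v), v⟫ ≤ ‖Q ((J - A) v)‖ * ‖v‖ := real_inner_le_norm _ _
      _ ≤ q * (‖J - A‖ * ‖v‖) * ‖v‖ := by
        gcongr
        exact (hQ _).trans (mul_le_mul_of_nonneg_left ((J - A).le_opNorm v) hq)
      _ = q * ‖J - A‖ * ‖v‖ ^ 2 := by ring
      _ ≤ ε * ‖v‖ ^ 2 := by gcongr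
  rw [sub_apply, map_sub, inner_sub_left] at herror
  linarith [hQA v]

variable [CompleteSpace U] [CompleteSpace X]

theorem exists_rightInverse_self_comp_adjoint (A : X →L[ℝ] U) {c : ℝ} (hc : 0 < c)
    (hA : ∀ z, c * ‖z‖ ^ 2 ≤ ‖A.adjoint z‖ ^ 2) :
    ∃ S : U →L[ℝ] U, ∀ z, A (A.adjoint (S z)) = z := by
  have hunit : IsUnit (A ∘L A.adjoint) := by
    refine ContinuousLinearMap.isUnit_of_forall_le_norm_inner_map _ (c := ⟨c, hc.le⟩) hc
      fun z => ?_
    rw [ContinuousLinearMap.comp_apply, ← A.adjoint_inner_right, real_inner_self_eq_norm_sq,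
      Real.norm_of_nonneg (sq_nonneg _), mul_comm]
    exact hA z
  obtain ⟨S, hS⟩ := hunit.exists_right_inv
  exact ⟨S, fun z => congr($hS z)⟩

theorem exists_rightInverse_norm_le (A : X →L[ℝ] U) {c : ℝ} (hc : 0 < c)
    (hA : ∀ z, c * ‖z‖ ^ 2 ≤ ‖A.adjoint z‖ ^ 2) :
    ∃ Q : U →L[ℝ] X, (∀ z, A (Q z) = z) ∧ (∀ z, ‖Q z‖ ≤ (√c)⁻¹ * ‖z‖) ∧
      ∀ v, ⟪Q (A v), v⟫ ≤ ‖v‖ ^ 2 := by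
  obtain ⟨S, hS⟩ := exists_rightInverse_self_comp_adjoint A hc hA
  have hnorm_sq : ∀ z, ‖A.adjoint (S z)‖ ^ 2 = ⟪S z, z⟫ := fun z => by
    rw [← real_inner_self_eq_norm_sq, A.adjoint_inner_left, hS]
  refine ⟨A.adjoint ∘L S, hS, fun z => ?_, fun v => ?_⟩ <;>
    rw [ContinuousLinearMap.comp_apply]
  · have hS_le : √c * ‖S z‖ ≤ ‖A.adjoint (S z)‖ := by
      refine le_of_sq_le_sq ?_ (norm_nonneg _)
      rw [mul_pow, Real.sq_sqrt hc.le]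
      exact hA _
    have hsq : ‖A.adjoint (S z)‖ ^ 2 ≤ ‖S z‖ * ‖z‖ := hnorm_sq z ▸ real_inner_le_norm _ _
    rw [inv_mul_eq_div, le_div_iff₀ (Real.sqrt_pos.2 hc)]
    rcases (norm_nonneg (A.adjoint (S z))).eq_or_lt with h0 | hpos
    · simp [← h0]
    · refine le_of_mul_le_mul_right ?_ hpos
      nlinarith [norm_nonneg z, Real.sqrt_nonneg c]
  · have hproj : ⟪A.adjoint (S (A v)), v⟫ = ‖A.adjoint (S (A v))‖ ^ 2 := by
      rw [hnorm_sq, A.adjoint_inner_left]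
    have hle := real_inner_le_norm (A.adjoint (S (A v))) v
    nlinarith [sq_nonneg (‖A.adjoint (S (A v))‖ - ‖v‖)]

theorem le_inner_rightInverse_adjoint (hAQ : ∀ z, A (Q z) = z) (hQ : ∀ z, ‖Q z‖ ≤ q * ‖z‖)
    (hJ : q * ‖J - A‖ ≤ ε) (z : U) : (1 - ε) * ‖z‖ ^ 2 ≤ ⟪Q z, J.adjoint z⟫ := by
  have herror : ⟪(A - J) (Q z), z⟫ ≤ ε * ‖z‖ ^ 2 :=
    calc ⟪(A - J) (Q z), z⟫ ≤ ‖(A - J) (Q z)‖ * ‖z‖ := real_inner_le_norm _ _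
      _ ≤ ‖A - J‖ * (q * ‖z‖) * ‖z‖ := by
        gcongr
        exact ((A - J).le_opNorm _).trans (mul_le_mul_of_nonneg_left (hQ z) (norm_nonneg _))
      _ = q * ‖J - A‖ * ‖z‖ ^ 2 := by rw [norm_sub_rev]; ring
      _ ≤ ε * ‖z‖ ^ 2 := by gcongr
  rw [sub_apply, hAQ, inner_sub_left, real_inner_self_eq_norm_sq] at herror
  rw [J.adjoint_inner_right]
  linarith

theorem IsDampedSystem.norm_residual_sq_le {α γ c t T : ℝ} {u : ℝ → U} {p : ℝ → X} (hγ : 0 < γ)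
    (hα : 0 < α) (hαγ : α ≤ 2 * γ / 3) (hc : 0 < c)
    (hA : ∀ z, c * ‖z‖ ^ 2 ≤ ‖A.adjoint z‖ ^ 2)
    (h : IsDampedSystem γ T (Metric.closedBall A (√c / 6)) u p) (ht : t ∈ Ioc 0 T) :
    ‖u t‖ ^ 2 ≤ 2 * (3 * (1 + γ + α) / √c / t) ^ α * ‖u 0‖ ^ 2 := by
  obtain ⟨Q, hAQ, hQ, hQA⟩ := exists_rightInverse_norm_le A hc hA
  have hsc : 0 < √c := Real.sqrt_pos.2 hc
  have hJ : ∀ J ∈ Metric.closedBall A (√c / 6), (√c)⁻¹ * ‖J - A‖ ≤ 1 / 6 := fun J hJ => by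
    rw [mem_closedBall_iff_norm] at hJ
    rw [inv_mul_le_iff₀ hsc]
    linarith
  rw [div_eq_mul_inv (3 * (1 + γ + α))]
  refine h.norm_residual_sq_le_of_inner_le hγ hα hαγ (inv_pos.2 hsc) hQ (fun J hmem v => ?_)
    (fun J hmem z => ?_) ht
  · linarith [inner_rightInverse_apply_le hQ hQA (inv_pos.2 hsc).le (hJ J hmem) v]
  · linarith [le_inner_rightInverse_adjoint hAQ hQ (hJ J hmem) z]

end RightInverse

section Displacement

variable {E : Type*} [NormedAddCommGroup E] [NormedSpace ℝ E]

theorem hasDerivAt_rpow_mul_velocity {γ s : ℝ} (hs : 0 < s) {v : ℝ → E} {g : E}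
    (hv : HasDerivAt v (-((γ / s) • v s) - g) s) (ℓ : E →L[ℝ] ℝ) :
    HasDerivAt (fun r => r ^ γ * ℓ (v r)) (-(s ^ γ * ℓ g)) s := by
  refine ((Real.hasDerivAt_rpow_const (Or.inl hs.ne')).mul
    (ℓ.hasFDerivAt.comp_hasDerivAt s hv)).congr_deriv ?_
  simp only [Function.comp_apply, map_sub, map_neg, map_smul, smul_eq_mul]
  rw [Real.rpow_sub_one hs.ne']
  field_simp
  ring

theorem apply_velocity_le {β γ M t : ℝ} (hβ : β < γ + 1) (hγ : 0 < γ) (ht : 0 < t) {v : ℝ → E}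
    (hv : ContinuousWithinAt v (Ioi 0) 0)
    (hvac : ∀ s ∈ Ioo 0 t, AbsolutelyContinuousOnInterval v s t)
    (hode : ∀ᵐ s, s ∈ Ioo 0 t → ∃ g, HasDerivAt v (-((γ / s) • v s) - g) s ∧
      ‖g‖ ≤ M * s ^ (-β))
    {ℓ : E →L[ℝ] ℝ} (hℓ : ‖ℓ‖ ≤ 1) : ℓ (v t) ≤ M * t ^ (1 - β) / (γ + 1 - β) := by
  have hβγ : 0 < γ + 1 - β := by linarith
  have hle : t ^ γ * ℓ (v t) - M / (γ + 1 - β) * t ^ (γ + 1 - β) ≤ 0 := by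
    refine le_of_tendsto_of_ae_hasDerivAt_nonpos
      (f := fun s => s ^ γ * ℓ (v s) - M / (γ + 1 - β) * s ^ (γ + 1 - β)) ht (fun s hs => ?_) ?_ ?_
    · exact ((absolutelyContinuousOnInterval_rpow hs.1 hs.2.le γ).fun_mul
        (absolutelyContinuousOnInterval_lipschitzWith_comp ℓ.lipschitz (hvac s hs))).fun_sub
        ((absolutelyContinuousOnInterval_rpow hs.1 hs.2.le (γ + 1 - β)).const_mul _)
    · filter_upwards [hode] with s hs hmem
      have hs₀ : 0 < s := hmem.1
      obtain ⟨g, hderiv, hg⟩ := hs hmem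
      have hforce : -ℓ g ≤ M * s ^ (-β) :=
        (neg_le_abs _).trans ((ℓ.le_of_opNorm_le hℓ g).trans (by rwa [one_mul]))
      refine ⟨s ^ γ * (-ℓ g - M * s ^ (-β)),
        mul_nonpos_of_nonneg_of_nonpos (by positivity) (sub_nonpos.2 hforce),
        ((hasDerivAt_rpow_mul_velocity hs₀ hderiv ℓ).sub ((Real.hasDerivAt_rpow_const
          (p := γ + 1 - β) (Or.inl hs₀.ne')).const_mul _)).congr_deriv ?_⟩
      have hpow : s ^ (γ + 1 - β - 1) = s ^ γ * s ^ (-β) := by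
        rw [← Real.rpow_add hs₀]
        ring_nf
      rw [hpow]
      field_simp
    · have hpow : ∀ r : ℝ, 0 < r → Tendsto (fun s : ℝ => s ^ r) (𝓝[>] 0) (𝓝 0) := fun r hr => by
        simpa [Real.zero_rpow hr.ne'] using
          (Real.continuousAt_rpow_const 0 r (Or.inr hr.le)).tendsto.mono_left nhdsWithin_le_nhds
      simpa using ((hpow γ hγ).mul ((ℓ.continuous.tendsto _).comp hv.tendsto)).sub
        ((hpow _ hβγ).const_mul (M / (γ + 1 - β)))
  have hpow : t ^ (γ + 1 - β) = t ^ γ * t ^ (1 - β) := by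
    rw [← Real.rpow_add ht]
    ring_nf
  refine le_of_mul_le_mul_left ?_ (Real.rpow_pos_of_pos ht γ)
  rw [hpow] at hle
  linarith [show M / (γ + 1 - β) * (t ^ γ * t ^ (1 - β)) =
    t ^ γ * (M * t ^ (1 - β) / (γ + 1 - β)) by ring]

theorem norm_velocity_le {β γ M t : ℝ} (hβ : β < γ + 1) (hγ : 0 < γ) (ht : 0 < t) {v : ℝ → E}
    (hv : ContinuousWithinAt v (Ioi 0) 0)
    (hvac : ∀ s ∈ Ioo 0 t, AbsolutelyContinuousOnInterval v s t)
    (hode : ∀ᵐ s, s ∈ Ioo 0 t → ∃ g, HasDerivAt v (-((γ / s) • v s) - g) s ∧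
      ‖g‖ ≤ M * s ^ (-β)) :
    ‖v t‖ ≤ M * t ^ (1 - β) / (γ + 1 - β) := by
  obtain ⟨ℓ, hℓ, hℓv⟩ := exists_dual_vector'' ℝ (v t)
  simpa [hℓv] using apply_velocity_le hβ hγ ht hv hvac hode hℓ

theorem norm_sub_le_of_norm_deriv_le {M τ : ℝ} (hτ : 0 ≤ τ) {w v : ℝ → E}
    (hw : ∀ t ∈ Icc 0 τ, HasDerivWithinAt w (v t) (Ici 0) t)
    (hv : ∀ t ∈ Icc 0 τ, ‖v t‖ ≤ M) : ‖w τ - w 0‖ ≤ M * τ := by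
  simpa [abs_of_nonneg hτ] using
    (convex_Icc 0 τ).norm_image_sub_le_of_norm_hasDerivWithin_le
      (fun t ht => (hw t ht).mono Icc_subset_Ici_self) hv ⟨le_rfl, hτ⟩ ⟨hτ, le_rfl⟩

theorem norm_sub_le_of_norm_deriv_le_rpow {β N τ t : ℝ} (hβ : 2 < β) (hτ : 0 < τ) (hτt : τ ≤ t)
    (hN : 0 ≤ N) {w v : ℝ → E} (hw : ∀ s ∈ Icc τ t, HasDerivWithinAt w (v s) (Ici 0) s)
    (hv : ∀ s ∈ Icc τ t, ‖v s‖ ≤ N * s ^ (1 - β)) :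
    ‖w t - w τ‖ ≤ N * τ ^ (2 - β) / (β - 2) := by
  have hβ' : 0 < β - 2 := by linarith
  have hIci : ∀ s ∈ Icc τ t, Ici s ⊆ Ici 0 := fun s hs => Ici_subset_Ici.2 (hτ.le.trans hs.1)
  have hbound : ‖w t - w τ‖ ≤ N / (β - 2) * (τ ^ (2 - β) - t ^ (2 - β)) := by
    refine image_norm_le_of_norm_deriv_right_le_deriv_boundary' (f := fun s => w s - w τ)
      (B := fun s => N / (β - 2) * (τ ^ (2 - β) - s ^ (2 - β))) (B' := fun s => N * s ^ (1 - β))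
      (fun s hs => ?_) (fun s hs => ?_) (by simp) (fun s hs => ?_) (fun s hs => ?_)
      (fun s hs => hv s (Ico_subset_Icc_self hs)) ⟨hτt, le_rfl⟩
    · exact ((hw s hs).continuousWithinAt.mono fun r hr => hτ.le.trans hr.1).sub
        continuousWithinAt_const
    · exact ((hw s (Ico_subset_Icc_self hs)).mono (hIci s (Ico_subset_Icc_self hs))).sub_const _
    · exact ((continuousAt_const.sub (Real.continuousAt_rpow_const _ _
        (Or.inl (hτ.trans_le hs.1).ne'))).const_mul _).continuousWithinAt
    · have hs₀ : s ≠ 0 := (hτ.trans_le hs.1).ne'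
      refine ((((Real.hasDerivAt_rpow_const (p := 2 - β) (Or.inl hs₀)).const_sub
        (τ ^ (2 - β))).const_mul (N / (β - 2))).congr_deriv ?_).hasDerivWithinAt
      rw [show 2 - β - 1 = 1 - β by ring]
      field_simp
      ring
  refine hbound.trans ?_
  rw [mul_div_right_comm]
  gcongr
  exact sub_le_self _ (Real.rpow_nonneg (hτ.le.trans hτt) _)

theorem norm_displacement_le_of_norm_velocity_le {β M N τ t : ℝ} (hβ : 2 < β) (hM : 0 ≤ M)
    (hN : 0 ≤ N) (hτ : 0 < τ) (ht : 0 ≤ t) {w v : ℝ → E}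
    (hw : ∀ s ∈ Icc 0 t, HasDerivWithinAt w (v s) (Ici 0) s)
    (hvM : ∀ s ∈ Icc 0 t, ‖v s‖ ≤ M * s) (hvN : ∀ s ∈ Ioc 0 t, ‖v s‖ ≤ N * s ^ (1 - β)) :
    ‖w t - w 0‖ ≤ M * τ ^ 2 + N * τ ^ (2 - β) / (β - 2) := by
  have hearly : ∀ s ∈ Icc 0 t, s ≤ τ → ‖w s - w 0‖ ≤ M * τ ^ 2 := fun s hs hsτ =>
    calc ‖w s - w 0‖ ≤ M * τ * s := norm_sub_le_of_norm_deriv_le hs.1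
          (fun r hr => hw r ⟨hr.1, hr.2.trans hs.2⟩) fun r hr =>
            (hvM r ⟨hr.1, hr.2.trans hs.2⟩).trans (by gcongr; exact hr.2.trans hsτ)
      _ ≤ M * τ * τ := by gcongr
      _ = M * τ ^ 2 := by ring
  rcases le_total t τ with htτ | hτt
  · exact (hearly t ⟨ht, le_rfl⟩ htτ).trans (le_add_of_nonneg_right (by positivity))
  · have hlate : ‖w t - w τ‖ ≤ N * τ ^ (2 - β) / (β - 2) :=
      norm_sub_le_of_norm_deriv_le_rpow hβ hτ hτt hN
        (fun s hs => hw s ⟨hτ.le.trans hs.1, hs.2⟩) fun s hs => hvN s ⟨hτ.trans_le hs.1, hs.2⟩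
    calc ‖w t - w 0‖ ≤ ‖w t - w τ‖ + ‖w τ - w 0‖ := norm_sub_le_norm_sub_add_norm_sub _ _ _
      _ ≤ _ := by linarith [hearly τ ⟨hτ.le, hτt⟩ le_rfl]

theorem norm_displacement_le {β γ τ G D t : ℝ} (hβ : 2 < β) (hβγ : β ≤ γ) (hG : 0 ≤ G)
    (hD : 0 ≤ D) (hτ : 0 < τ) (ht : 0 ≤ t) {w v : ℝ → E}
    (hw : ∀ s ∈ Icc 0 t, HasDerivWithinAt w (v s) (Ici 0) s) (hv₀ : v 0 = 0)
    (hv : ContinuousWithinAt v (Ioi 0) 0)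
    (hvac : ∀ s₁ s₂, 0 < s₁ → s₁ ≤ s₂ → AbsolutelyContinuousOnInterval v s₁ s₂)
    (hode : ∀ᵐ s, s ∈ Ioo 0 t → ∃ g, HasDerivAt v (-((γ / s) • v s) - g) s ∧
      ‖g‖ ≤ G ∧ ‖g‖ ≤ D * (τ / s) ^ β) :
    ‖w t - w 0‖ ≤ (G + D / (β - 2)) * τ ^ 2 := by
  have hγ : 0 < γ := by linarith
  have hvG : ∀ s ∈ Icc 0 t, ‖v s‖ ≤ G * s := fun s hs => by
    rcases hs.1.eq_or_lt with rfl | hs₀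
    · simp [hv₀]
    refine (norm_velocity_le (β := 0) (M := G) (by linarith) hγ hs₀ hv
      (fun r hr => hvac r s hr.1 hr.2.le) ?_).trans ?_
    · filter_upwards [hode] with r hr hmem
      obtain ⟨g, hderiv, hg, -⟩ := hr ⟨hmem.1, hmem.2.trans_le hs.2⟩
      exact ⟨g, hderiv, by simpa using hg⟩
    · rw [sub_zero, sub_zero, Real.rpow_one]
      exact div_le_self (mul_nonneg hG hs.1) (by linarith)
  have hvD : ∀ s ∈ Ioc 0 t, ‖v s‖ ≤ D * τ ^ β * s ^ (1 - β) := fun s hs => by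
    have hs₀ : 0 < s := hs.1
    refine (norm_velocity_le (β := β) (M := D * τ ^ β) (by linarith) hγ hs.1 hv
      (fun r hr => hvac r s hr.1 hr.2.le) ?_).trans (div_le_self (by positivity) (by linarith))
    filter_upwards [hode] with r hr hmem
    obtain ⟨g, hderiv, -, hg⟩ := hr ⟨hmem.1, hmem.2.trans_le hs.2⟩
    refine ⟨g, hderiv, hg.trans_eq ?_⟩
    rw [Real.div_rpow hτ.le hmem.1.le, Real.rpow_neg hmem.1.le, mul_assoc, div_eq_mul_inv]
  refine (norm_displacement_le_of_norm_velocity_le hβ hG (by positivity) hτ ht hw hvG hvD).trans_eq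
    ?_
  rw [mul_assoc, ← Real.rpow_add hτ, add_sub_cancel, Real.rpow_two]
  ring

end Displacement

section Bootstrap

theorem forall_le_of_forall_lt_of_continuousOn {ψ : ℝ → ℝ} {R T : ℝ} (hψ : ContinuousOn ψ (Icc 0 T))
    (h₀ : ψ 0 ≤ R)
    (hstep : ∀ t ∈ Icc 0 T, (∀ s ∈ Icc 0 t, ψ s ≤ R) → ψ t < R) :
    ∀ t ∈ Icc 0 T, ψ t ≤ R := by
  refine IsClosed.Icc_subset_of_forall_mem_nhdsGT_of_Icc_subset (s := {t | ψ t ≤ R}) ?_ h₀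
    fun t ht hle => ?_
  · rw [inter_comm]
    exact hψ.preimage_isClosed_of_isClosed isClosed_Icc isClosed_Iic
  · have hlt := hstep t (Ico_subset_Icc_self ht) hle
    have hlim : Tendsto ψ (𝓝[>] t) (𝓝 (ψ t)) :=
      ((hψ t (Ico_subset_Icc_self ht)).mono_of_mem_nhdsWithin
        (Icc_mem_nhdsGT_of_mem ht)).tendsto
    exact (hlim.eventually_lt_const hlt).mono fun _ => le_of_lt

end Bootstrap

section Relu

theorem lipschitzWith_relu : LipschitzWith 1 relu :=
  LipschitzWith.of_dist_le_mul fun y z => by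
    simpa [relu, Real.dist_eq] using abs_max_sub_max_le_abs y z 0

theorem relu_eq_add_relu_neg (z : ℝ) : relu z = z + relu (-z) := by
  rcases le_total z 0 with hz | hz <;> simp [relu, hz]

theorem hasDerivAt_relu_comp {f : ℝ → ℝ} {f' t s : ℝ} (hf : HasDerivAt f f' t)
    (hdiff : DifferentiableAt ℝ (fun τ => relu (f τ)) t) (hs : s ∈ reluSlope (f t)) :
    HasDerivAt (fun τ => relu (f τ)) (s * f') t := by
  rcases lt_trichotomy (f t) 0 with hneg | hzero | hpos
  · rw [hs.2.1 hneg, zero_mul]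
    refine (hasDerivAt_const t (0 : ℝ)).congr_of_eventuallyEq ?_
    filter_upwards [hf.continuousAt.eventually_lt_const hneg] with τ hτ using max_eq_right hτ.le
  · -- Both `relu ∘ f` and `relu ∘ (-f)` have a minimum at `t`, and they differ by `f`.
    have hmin : ∀ g : ℝ → ℝ, g t = 0 → IsLocalMin (fun τ => relu (g τ)) t := fun g hg =>
      Eventually.of_forall fun τ => by simp [relu, hg]
    have hderiv : HasDerivAt (fun τ => relu (f τ)) 0 t :=
      (hmin f hzero).deriv_eq_zero ▸ hdiff.hasDerivAt
    have hderiv_neg : HasDerivAt (fun τ => relu (-f τ)) (0 - f') t :=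
      (hderiv.sub hf).congr_of_eventuallyEq <| Eventually.of_forall fun τ =>
        eq_sub_of_add_eq' (relu_eq_add_relu_neg (f τ)).symm
    have hf' : f' = 0 := by
      simpa using (hmin (fun τ => -f τ) (by simp [hzero])).hasDerivAt_eq_zero hderiv_neg
    rwa [hf', mul_zero]
  · rw [hs.1 hpos, one_mul]
    refine hf.congr_of_eventuallyEq ?_
    filter_upwards [hf.continuousAt.eventually_const_lt hpos] with τ hτ using max_eq_left hτ.le

end Relu

section Jacobian

/-- The Hilbert space of all hidden-layer weights `(w₁, …, wₘ)`. -/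
abbrev WeightSpace (m p : ℕ) : Type := PiLp 2 fun _ : Fin m => EuclideanSpace ℝ (Fin p)

variable {n m p : ℕ} (x : Fin n → EuclideanSpace ℝ (Fin p)) (a : Fin m → ℝ)

-- A shortcut: the default search for this instance times out.
instance : ContinuousSMul ℝ (WeightSpace m p) := NormedSpace.toIsBoundedSMul.continuousSMul

/-- A family of weights as a point of the Hilbert space of all weights. -/
noncomputable def stack (W : Fin m → EuclideanSpace ℝ (Fin p)) : WeightSpace m p :=
  WithLp.toLp 2 W

/-- The Jacobian of `W ↦ (f(W, a, xᵢ))ᵢ` when the slope `σ'(wᵣᵀ xᵢ)` takes the value `s r i`. -/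
noncomputable def jacobian (s : Fin m → Fin n → ℝ) :
    WeightSpace m p →L[ℝ] EuclideanSpace ℝ (Fin n) :=
  (PiLp.continuousLinearEquiv 2 ℝ fun _ : Fin n => ℝ).symm.toContinuousLinearMap ∘L
    ContinuousLinearMap.pi fun i => (1 / √(m : ℝ)) • ∑ r, (a r * s r i) •
      (innerSL ℝ (x i) ∘L PiLp.proj 2 (fun _ : Fin m => EuclideanSpace ℝ (Fin p)) r)

theorem jacobian_apply (s : Fin m → Fin n → ℝ) (v : WeightSpace m p) (i : Fin n) :
    jacobian x a s v i = 1 / √(m : ℝ) * ∑ r, a r * (s r i * ⟪v r, x i⟫) := by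
  simp [jacobian, mul_assoc, real_inner_comm]

theorem jacobian_adjoint_apply (s : Fin m → Fin n → ℝ) (z : EuclideanSpace ℝ (Fin n)) :
    (jacobian x a s).adjoint z =
      stack fun r => ∑ i, (z i * (1 / √(m : ℝ) * a r * s r i)) • x i := by
  refine ext_inner_right ℝ fun v => ?_
  rw [ContinuousLinearMap.adjoint_inner_left, PiLp.inner_apply, PiLp.inner_apply]
  simp only [stack, jacobian_apply, sum_inner, real_inner_smul_left, RCLike.inner_apply,
    conj_trivial, Finset.mul_sum, Finset.sum_mul]
  rw [Finset.sum_comm]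
  refine Finset.sum_congr rfl fun r _ => Finset.sum_congr rfl fun i _ => ?_
  rw [real_inner_comm (v r)]
  ring

theorem jacobian_sub (s s' : Fin m → Fin n → ℝ) :
    jacobian x a (s - s') = jacobian x a s - jacobian x a s' := by
  ext v i
  simp only [jacobian_apply, sub_apply, PiLp.sub_apply, Pi.sub_apply, ← mul_sub,
    ← Finset.sum_sub_distrib, sub_mul]

variable {x a}

theorem norm_jacobian_le (hx : ∀ i, ‖x i‖ ≤ 1) (ha : ∀ r, |a r| ≤ 1) (s : Fin m → Fin n → ℝ) :
    ‖jacobian x a s‖ ≤ √((∑ i, ∑ r, s r i ^ 2) / m) := by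
  refine ContinuousLinearMap.opNorm_le_bound _ (Real.sqrt_nonneg _) fun v => ?_
  have hterm : ∀ i r, (a r * ⟪v r, x i⟫) ^ 2 ≤ ‖v r‖ ^ 2 := fun i r => by
    refine sq_le_sq.2 ?_
    rw [abs_norm, abs_mul]
    calc |a r| * |⟪v r, x i⟫| ≤ 1 * (‖v r‖ * 1) := by
          gcongr
          · exact ha r
          · exact (abs_real_inner_le_norm _ _).trans (by gcongr; exact hx i)
      _ = ‖v r‖ := by ring
  refine le_of_sq_le_sq ?_ (by positivity)
  rw [mul_pow, Real.sq_sqrt (by positivity), EuclideanSpace.real_norm_sq_eq,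
    PiLp.norm_sq_eq_of_L2, Finset.sum_div, Finset.sum_mul]
  gcongr with i
  calc jacobian x a s v i ^ 2 = (∑ r, s r i * (a r * ⟪v r, x i⟫)) ^ 2 / m := by
        rw [jacobian_apply, mul_pow, div_pow, one_pow, Real.sq_sqrt (Nat.cast_nonneg m),
          one_div_mul_eq_div]
        simp only [mul_left_comm]
    _ ≤ (∑ r, s r i ^ 2) * (∑ r, (a r * ⟪v r, x i⟫) ^ 2) / m := by
        gcongr
        exact Finset.sum_mul_sq_le_sq_mul_sq _ _ _
    _ ≤ (∑ r, s r i ^ 2) * (∑ r, ‖v r‖ ^ 2) / m := by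
        gcongr _ * (∑ r, ?_) / _ with r
        exact hterm i r
    _ = (∑ r, s r i ^ 2) / m * ∑ r, ‖v r‖ ^ 2 := div_mul_eq_mul_div _ _ _ |>.symm

end Jacobian

section Patterns

/-- The indicator `𝕀{⟪w, x⟫ ≥ 0}`. -/
noncomputable def gate {E : Type*} [NormedAddCommGroup E] [InnerProductSpace ℝ E] (w x : E) : ℝ :=
  if 0 ≤ ⟪w, x⟫ then 1 else 0

variable {n m p : ℕ} (x : Fin n → EuclideanSpace ℝ (Fin p)) (a : Fin m → ℝ)
  (W : Fin m → EuclideanSpace ℝ (Fin p))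

/-- The activation pattern of the hidden layer on the training inputs, that is the slopes
`σ'(wᵣᵀ xᵢ)` with the convention `σ'(0) = 1`. -/
noncomputable def pattern (r : Fin m) (i : Fin n) : ℝ := gate (W r) (x i)

/-- The Jacobians at `W` of the network outputs for all admissible choices of the slopes
`σ'(wᵣᵀ xᵢ)`. -/
def admissibleJacobians : Set (WeightSpace m p →L[ℝ] EuclideanSpace ℝ (Fin n)) :=
  jacobian x a '' {s | ∀ r i, s r i ∈ reluSlope ⟪W r, x i⟫}

/-- The number of pairs `(i, r)` with `|wᵣᵀ xᵢ| ≤ R`. When the weights move by at most `R`, only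
these pairs can change their activation. -/
noncomputable def nearKinkCount (R : ℝ) : ℝ := ∑ i, ∑ r, if |⟪W r, x i⟫| ≤ R then 1 else 0

variable {x a W}

theorem sq_sub_gate_le {w w' ξ : EuclideanSpace ℝ (Fin p)} {R s : ℝ}
    (hξ : ‖ξ‖ ≤ 1) (hw : ‖w' - w‖ ≤ R) (hs : s ∈ reluSlope ⟪w', ξ⟫) :
    (s - gate w ξ) ^ 2 ≤ if |⟪w, ξ⟫| ≤ R then 1 else 0 := by
  have hclose : |⟪w', ξ⟫ - ⟪w, ξ⟫| ≤ R := by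
    rw [← inner_sub_left]
    calc |⟪w' - w, ξ⟫| ≤ ‖w' - w‖ * ‖ξ‖ := abs_real_inner_le_norm _ _
      _ ≤ ‖w' - w‖ * 1 := by gcongr
      _ ≤ R := by rwa [mul_one]
  obtain ⟨hs_pos, hs_neg, hs₀, hs₁⟩ := hs
  rw [abs_le] at hclose
  unfold gate
  split_ifs with hactive hnear hnear
  · nlinarith
  · rw [abs_of_nonneg hactive] at hnear
    simp [hs_pos (by linarith)]
  · nlinarith
  · rw [abs_of_neg (not_le.1 hactive)] at hnear
    simp [hs_neg (by linarith)]

theorem norm_sub_jacobian_pattern_le (hx : ∀ i, ‖x i‖ ≤ 1) (ha : ∀ r, |a r| ≤ 1)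
    {W' : Fin m → EuclideanSpace ℝ (Fin p)} {R : ℝ} (hW : ∀ r, ‖W' r - W r‖ ≤ R)
    {J : WeightSpace m p →L[ℝ] EuclideanSpace ℝ (Fin n)} (hJ : J ∈ admissibleJacobians x a W') :
    ‖J - jacobian x a (pattern x W)‖ ≤ √(nearKinkCount x W R / m) := by
  obtain ⟨s, hs, rfl⟩ := hJ
  rw [← jacobian_sub]
  refine (norm_jacobian_le hx ha _).trans (Real.sqrt_le_sqrt ?_)
  unfold nearKinkCount
  gcongr with i _ r _
  exact sq_sub_gate_le (hx i) (hW r) (hs r i)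

end Patterns

section Residuals

variable {n m p : ℕ} {x : Fin n → EuclideanSpace ℝ (Fin p)} {y : Fin n → ℝ} {a : Fin m → ℝ}

/-- The vector of residuals `f(W, a, xᵢ) - yᵢ`. -/
noncomputable def residuals (x : Fin n → EuclideanSpace ℝ (Fin p)) (y : Fin n → ℝ)
    (W : Fin m → EuclideanSpace ℝ (Fin p)) (a : Fin m → ℝ) : EuclideanSpace ℝ (Fin n) :=
  WithLp.toLp 2 fun i => network W a (x i) - y i

theorem norm_residuals_sq (W : Fin m → EuclideanSpace ℝ (Fin p)) :
    ‖residuals x y W a‖ ^ 2 = 2 * loss x y W a := by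
  rw [EuclideanSpace.real_norm_sq_eq, loss]
  simp only [residuals]
  ring

theorem hasDerivAt_toLp {ι : Type*} [Fintype ι] {E : ι → Type*} [∀ i, NormedAddCommGroup (E i)]
    [∀ i, NormedSpace ℝ (E i)] {f : ℝ → ∀ i, E i} {f' : PiLp 2 E} {t : ℝ}
    (hf : ∀ i, HasDerivAt (fun t => f t i) (f' i) t) :
    HasDerivAt (fun t => WithLp.toLp 2 (f t)) f' t :=
  (PiLp.hasFDerivAt_toLp 2 (f t)).comp_hasDerivAt t (hasDerivAt_pi.2 hf)

theorem hasDerivAt_residuals {W : ℝ → Fin m → EuclideanSpace ℝ (Fin p)}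
    {v : Fin m → EuclideanSpace ℝ (Fin p)} {t : ℝ}
    (hW : ∀ r, HasDerivAt (fun τ => W τ r) (v r) t)
    (hdiff : ∀ r i, DifferentiableAt ℝ (fun τ => relu ⟪W τ r, x i⟫) t)
    {J : WeightSpace m p →L[ℝ] EuclideanSpace ℝ (Fin n)}
    (hJ : J ∈ admissibleJacobians x a (W t)) :
    HasDerivAt (fun τ => residuals x y (W τ) a) (J (stack v)) t := by
  obtain ⟨s, hs, rfl⟩ := hJ
  refine hasDerivAt_toLp fun i => ?_
  rw [jacobian_apply]
  refine ((HasDerivAt.fun_sum fun r _ => ?_).const_mul _).sub_const _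
  refine (hasDerivAt_relu_comp ?_ (hdiff r i) (hs r i)).const_mul (a r)
  simpa [stack] using (hW r).inner ℝ (hasDerivAt_const t (x i))

variable {W g : Fin m → EuclideanSpace ℝ (Fin p)}

theorem exists_admissibleJacobian_stack_eq_adjoint (hg : IsLossGradient x y W a g) :
    ∃ J ∈ admissibleJacobians x a W, stack g = J.adjoint (residuals x y W a) := by
  obtain ⟨s, hs, hg⟩ := hg
  refine ⟨_, mem_image_of_mem _ hs, ?_⟩
  rw [jacobian_adjoint_apply, funext hg]
  rfl

theorem norm_lossGradient_le (hx : ∀ i, ‖x i‖ ≤ 1) (ha : ∀ r, |a r| ≤ 1)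
    (hg : IsLossGradient x y W a g) (r : Fin m) :
    ‖g r‖ ≤ √(n / m) * ‖residuals x y W a‖ := by
  obtain ⟨s, hs, hg⟩ := hg
  set u := residuals x y W a
  have hterm : ∀ i, ‖(u i * (1 / √(m : ℝ) * a r * s r i)) • x i‖ ≤ |u i| / √m := fun i => by
    obtain ⟨-, -, hs₀, hs₁⟩ := hs r i
    have hcoeff : |a r| * |s r i| * ‖x i‖ ≤ 1 :=
      mul_le_one₀ (mul_le_one₀ (ha r) (abs_nonneg _) ((abs_of_nonneg hs₀).trans_le hs₁))
        (norm_nonneg _) (hx i)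
    calc ‖(u i * (1 / √(m : ℝ) * a r * s r i)) • x i‖
        = |u i| / √m * (|a r| * |s r i| * ‖x i‖) := by
          rw [norm_smul, Real.norm_eq_abs, abs_mul, abs_mul, abs_mul,
            abs_of_nonneg (by positivity : 0 ≤ 1 / √(m : ℝ))]
          ring
      _ ≤ |u i| / √m := mul_le_of_le_one_right (by positivity) hcoeff
  have hsum : ∑ i, |u i| ≤ √n * ‖u‖ := by
    refine le_of_sq_le_sq ?_ (by positivity)
    rw [mul_pow, Real.sq_sqrt (Nat.cast_nonneg n), EuclideanSpace.real_norm_sq_eq]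
    simpa using sq_sum_le_card_mul_sum_sq (s := Finset.univ) (f := fun i => |u i|)
  calc ‖g r‖ ≤ ∑ i, |u i| / √m := by
        rw [hg r]
        exact (norm_sum_le _ _).trans (Finset.sum_le_sum fun i _ => hterm i)
    _ = (∑ i, |u i|) / √m := (Finset.sum_div _ _ _).symm
    _ ≤ √n * ‖u‖ / √m := by gcongr
    _ = √(n / m) * ‖u‖ := by rw [Real.sqrt_div (Nat.cast_nonneg n)]; ring

end Residuals

section NesterovFlow

variable {n m p : ℕ} {γ : ℝ} {x : Fin n → EuclideanSpace ℝ (Fin p)} {y : Fin n → ℝ}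
  {a : Fin m → ℝ} {W₀ : Fin m → EuclideanSpace ℝ (Fin p)}
  {W V : ℝ → Fin m → EuclideanSpace ℝ (Fin p)} {s t T : ℝ}

namespace IsNesterovFlow

theorem absolutelyContinuousOnInterval_position (h : IsNesterovFlow γ x y a W₀ W V) (hs : 0 ≤ s)
    (hst : s ≤ t) (r : Fin m) : AbsolutelyContinuousOnInterval (fun τ => W τ r) s t := by
  have hsub : Icc s t ⊆ Ici 0 := fun τ hτ => hs.trans hτ.1
  obtain ⟨C, hC⟩ := isCompact_Icc.exists_bound_of_continuousOn ((h.continuous_vel r).mono hsub)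
  apply LipschitzOnWith.absolutelyContinuousOnInterval (K := C.toNNReal)
  rw [uIcc_of_le hst]
  exact (convex_Icc s t).lipschitzOnWith_of_nnnorm_hasDerivWithin_le
    (fun τ hτ => (h.hasDeriv r τ (hsub hτ)).mono hsub)
    fun τ hτ => NNReal.coe_le_coe.1 ((hC τ hτ).trans (Real.le_coe_toNNReal C))

theorem absolutelyContinuousOnInterval_relu (h : IsNesterovFlow γ x y a W₀ W V) (hs : 0 ≤ s)
    (hst : s ≤ t) (r : Fin m) (i : Fin n) :
    AbsolutelyContinuousOnInterval (fun τ => relu ⟪W τ r, x i⟫) s t := by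
  simpa only [Function.comp_apply, innerSL_apply_apply, real_inner_comm (x i)] using
    absolutelyContinuousOnInterval_lipschitzWith_comp
      (lipschitzWith_relu.comp (innerSL ℝ (x i)).lipschitz)
      (h.absolutelyContinuousOnInterval_position hs hst r)

theorem absolutelyContinuousOnInterval_residuals (h : IsNesterovFlow γ x y a W₀ W V) (hs : 0 ≤ s)
    (hst : s ≤ t) : AbsolutelyContinuousOnInterval (fun τ => residuals x y (W τ) a) s t :=
  absolutelyContinuousOnInterval_toLp fun i =>
    ((absolutelyContinuousOnInterval_finset_sum _ fun r _ =>
      (h.absolutelyContinuousOnInterval_relu hs hst r i).const_mul (a r)).const_mul _).fun_sub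
      (LipschitzWith.const (y i)).lipschitzOnWith.absolutelyContinuousOnInterval

theorem ae_exists_hasDerivAt (h : IsNesterovFlow γ x y a W₀ W V) (hT : 0 ≤ T) :
    ∀ᵐ t, t ∈ Ioo 0 T → ∃ J ∈ admissibleJacobians x a (W t),
      HasDerivAt (fun τ => residuals x y (W τ) a) (J (stack (V t))) t ∧
      HasDerivAt (fun τ => stack (V τ))
        (-((γ / t) • stack (V t)) - J.adjoint (residuals x y (W t) a)) t := by
  have hdiff : ∀ᵐ t, ∀ r i, t ∈ uIcc 0 T →
      DifferentiableAt ℝ (fun τ => relu ⟪W τ r, x i⟫) t := by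
    simp only [ae_all_iff]
    exact fun r i => (h.absolutelyContinuousOnInterval_relu le_rfl hT r i).ae_differentiableAt
  filter_upwards [hdiff, (ae_restrict_iff' measurableSet_Ioi).1 h.equation] with t hdiff heq ht
  obtain ⟨g, hg, hderiv⟩ := heq ht.1
  obtain ⟨J, hJ, hgJ⟩ := exists_admissibleJacobian_stack_eq_adjoint hg
  refine ⟨J, hJ, hasDerivAt_residuals
    (fun r => (h.hasDeriv r t ht.1.le).hasDerivAt (Ici_mem_nhds ht.1))
    (fun r i => hdiff r i (Ioo_subset_Icc_self.trans Icc_subset_uIcc ht)) hJ, ?_⟩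
  rw [← hgJ]
  exact hasDerivAt_toLp hderiv

theorem isDampedSystem (h : IsNesterovFlow γ x y a W₀ W V) (hT : 0 ≤ T)
    {𝒥 : Set (WeightSpace m p →L[ℝ] EuclideanSpace ℝ (Fin n))}
    (h𝒥 : ∀ t ∈ Icc 0 T, admissibleJacobians x a (W t) ⊆ 𝒥) :
    IsDampedSystem γ T 𝒥 (fun t => residuals x y (W t) a) fun t => stack (V t) where
  continuousOn_residual := by
    simpa only [uIcc_of_le hT] using
      (h.absolutelyContinuousOnInterval_residuals le_rfl hT).continuousOn
  continuousOn_velocity := (PiLp.continuous_toLp 2 _).comp_continuousOn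
    (continuousOn_pi.2 fun r => (h.continuous_vel r).mono Icc_subset_Ici_self)
  absCont_residual _ _ hs hst _ := h.absolutelyContinuousOnInterval_residuals hs.le hst
  absCont_velocity _ _ hs hst _ :=
    absolutelyContinuousOnInterval_toLp fun r => h.absCont_vel r _ _ hs hst
  velocity_zero := by rw [h.init_vel]; rfl
  equation := by
    filter_upwards [h.ae_exists_hasDerivAt hT] with t heq ht
    obtain ⟨J, hJ, hderiv⟩ := heq ht
    exact ⟨J, h𝒥 t (Ioo_subset_Icc_self ht) hJ, hderiv⟩

theorem norm_residuals_le (h : IsNesterovFlow γ x y a W₀ W V) (hγ : 0 ≤ γ) (ht : 0 ≤ t) :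
    ‖residuals x y (W t) a‖ ≤ ‖residuals x y (W 0) a‖ :=
  (h.isDampedSystem ht fun _ _ => subset_univ _).norm_residual_le hγ ⟨ht, le_rfl⟩

end IsNesterovFlow

/-- The two properties of the initial weights `W₀` that keep the flow in the linear regime: the
adjoint Jacobian at `W₀` is bounded below by `√c`, and few enough units are so close to their kink
that Jacobians at weights within `R` of `W₀` differ from it by at most `√c / 6`. -/
structure IsWellConditioned (x : Fin n → EuclideanSpace ℝ (Fin p)) (a : Fin m → ℝ)
    (W₀ : Fin m → EuclideanSpace ℝ (Fin p)) (c R : ℝ) : Prop where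
  norm_adjoint_ge : ∀ z, c * ‖z‖ ^ 2 ≤ ‖(jacobian x a (pattern x W₀)).adjoint z‖ ^ 2
  nearKinkCount_div_le : nearKinkCount x W₀ R / m ≤ c / 36

/-- The radius of the ball which a flow with initial residual of norm `u₀` does not leave, when it
starts from weights that are well conditioned with lower bound `c`. -/
noncomputable def displacementRadius (n m : ℕ) (α γ c u₀ : ℝ) : ℝ :=
  √(n / m) * u₀ * (1 + √2 / (α / 2 - 2)) * ((3 * (1 + γ + α)) ^ 2 / c)

namespace IsWellConditioned

variable {α c R : ℝ}

theorem admissibleJacobians_subset_closedBall (hc : IsWellConditioned x a W₀ c R)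
    (hx : ∀ i, ‖x i‖ ≤ 1) (ha : ∀ r, |a r| ≤ 1) {W' : Fin m → EuclideanSpace ℝ (Fin p)}
    (hW' : ∀ r, ‖W' r - W₀ r‖ ≤ R) :
    admissibleJacobians x a W' ⊆ Metric.closedBall (jacobian x a (pattern x W₀)) (√c / 6) :=
  fun J hJ => mem_closedBall_iff_norm.2 <|
    calc ‖J - jacobian x a (pattern x W₀)‖ ≤ √(nearKinkCount x W₀ R / m) :=
          norm_sub_jacobian_pattern_le hx ha hW' hJ
      _ ≤ √(c / 6 ^ 2) :=
          Real.sqrt_le_sqrt (hc.nearKinkCount_div_le.trans_eq (by norm_num))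
      _ = √c / 6 := by rw [Real.sqrt_div' _ (by norm_num), Real.sqrt_sq (by norm_num)]

theorem norm_residuals_sq_le (hc : IsWellConditioned x a W₀ c R) (hc₀ : 0 < c)
    (hx : ∀ i, ‖x i‖ ≤ 1) (ha : ∀ r, |a r| ≤ 1) (h : IsNesterovFlow γ x y a W₀ W V)
    (hγ : 0 < γ) (hα : 0 < α) (hαγ : α ≤ 2 * γ / 3)
    (hclose : ∀ s ∈ Icc 0 t, ∀ r, ‖W s r - W₀ r‖ ≤ R) (ht : 0 < t) :
    ‖residuals x y (W t) a‖ ^ 2 ≤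
      2 * (3 * (1 + γ + α) / √c / t) ^ α * ‖residuals x y (W 0) a‖ ^ 2 :=
  (h.isDampedSystem ht.le fun s hs =>
    hc.admissibleJacobians_subset_closedBall hx ha (hclose s hs)).norm_residual_sq_le
      hγ hα hαγ hc₀ hc.norm_adjoint_ge ⟨ht, le_rfl⟩

theorem norm_sub_le_displacementRadius (hc : IsWellConditioned x a W₀ c R) (hc₀ : 0 < c)
    (hx : ∀ i, ‖x i‖ ≤ 1) (ha : ∀ r, |a r| ≤ 1) (h : IsNesterovFlow γ x y a W₀ W V)
    (hα : 4 < α) (hαγ : α ≤ 2 * γ / 3) (ht : 0 ≤ t)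
    (hclose : ∀ s ∈ Icc 0 t, ∀ r, ‖W s r - W₀ r‖ ≤ R) (r : Fin m) :
    ‖W t r - W₀ r‖ ≤ displacementRadius n m α γ c ‖residuals x y W₀ a‖ := by
  have hγ : 0 < γ := by linarith
  set u₀ := ‖residuals x y W₀ a‖
  set τ := 3 * (1 + γ + α) / √c with hτ_def
  have hτ : 0 < τ := by have := Real.sqrt_pos.2 hc₀; positivity
  have hdecay : ∀ s ∈ Ioo 0 t, ‖residuals x y (W s) a‖ ≤ √2 * u₀ * (τ / s) ^ (α / 2) := by
    intro s hs
    refine le_of_sq_le_sq ?_ (by have := hs.1; positivity)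
    have hpow : ((τ / s) ^ (α / 2)) ^ 2 = (τ / s) ^ α := by
      rw [← Real.rpow_mul_natCast (by have := hs.1; positivity)]
      norm_num
    refine (hc.norm_residuals_sq_le hc₀ hx ha h hγ (by linarith) hαγ
      (fun s' hs' => hclose s' ⟨hs'.1, hs'.2.trans hs.2.le⟩) hs.1).trans_eq ?_
    rw [mul_pow, mul_pow, hpow, Real.sq_sqrt two_pos.le, h.init_pos]
    ring
  have hdisp := norm_displacement_le (β := α / 2) (γ := γ) (G := √(n / m) * u₀)
    (D := √(n / m) * (√2 * u₀)) (w := fun s => W s r) (v := fun s => V s r) (by linarith)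
    (by linarith) (by positivity) (by positivity) hτ ht (fun s hs => h.hasDeriv r s hs.1)
    (by rw [h.init_vel]; rfl) ((h.continuous_vel r 0 self_mem_Ici).mono Ioi_subset_Ici_self)
    (h.absCont_vel r) ?_
  · rw [h.init_pos] at hdisp
    refine hdisp.trans_eq ?_
    rw [displacementRadius, hτ_def, div_pow _ (√c), Real.sq_sqrt hc₀.le]
    ring
  filter_upwards [(ae_restrict_iff' measurableSet_Ioi).1 h.equation] with s heq hs
  obtain ⟨g, hg, hderiv⟩ := heq hs.1
  have hforce := norm_lossGradient_le hx ha hg r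
  refine ⟨g r, hderiv r, hforce.trans ?_, hforce.trans ?_⟩
  · gcongr
    exact (h.norm_residuals_le hγ.le hs.1.le).trans_eq (by rw [h.init_pos])
  · rw [mul_assoc]
    gcongr
    exact hdecay s hs

theorem norm_sub_le (hc : IsWellConditioned x a W₀ c R) (hc₀ : 0 < c) (hx : ∀ i, ‖x i‖ ≤ 1)
    (ha : ∀ r, |a r| ≤ 1) (h : IsNesterovFlow γ x y a W₀ W V) (hα : 4 < α)
    (hαγ : α ≤ 2 * γ / 3) (hR : 0 < R)
    (hR' : displacementRadius n m α γ c ‖residuals x y W₀ a‖ < R) (ht : 0 ≤ t) (r : Fin m) :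
    ‖W t r - W₀ r‖ ≤ R := by
  have hcont : ContinuousOn (fun s => ‖W s - W₀‖) (Icc 0 t) :=
    ((continuousOn_pi.2 fun r s hs => (h.hasDeriv r s hs.1).continuousWithinAt.mono
      Icc_subset_Ici_self).sub continuousOn_const).norm
  refine (pi_norm_le_iff_of_nonneg hR.le).1 (forall_le_of_forall_lt_of_continuousOn hcont
    (by simpa [h.init_pos] using hR.le) (fun s hs hle => ?_) t ⟨ht, le_rfl⟩) r
  refine (pi_norm_lt_iff hR).2 fun r => lt_of_le_of_lt ?_ hR'
  exact hc.norm_sub_le_displacementRadius hc₀ hx ha h hα hαγ hs.1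
    (fun s' hs' => (pi_norm_le_iff_of_nonneg hR.le).1 (hle s' hs')) r

theorem loss_le (hc : IsWellConditioned x a W₀ c R) (hc₀ : 0 < c) (hx : ∀ i, ‖x i‖ ≤ 1)
    (ha : ∀ r, |a r| ≤ 1) (h : IsNesterovFlow γ x y a W₀ W V) (hα : 4 < α)
    (hαγ : α ≤ 2 * γ / 3) (hR : 0 < R)
    (hR' : displacementRadius n m α γ c ‖residuals x y W₀ a‖ < R) (ht : 0 < t) :
    loss x y (W t) a ≤
      2 * (3 * (1 + γ + α)) ^ α / c ^ (α / 2) * t ^ (-α) * loss x y (W 0) a := by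
  have hγ : 0 < γ := by linarith
  have hdecay := hc.norm_residuals_sq_le hc₀ hx ha h hγ (by linarith) hαγ
    (fun s hs r => hc.norm_sub_le hc₀ hx ha h hα hαγ hR hR' hs.1 r) ht
  have hpow : (√c) ^ α = c ^ (α / 2) := by
    rw [Real.sqrt_eq_rpow, ← Real.rpow_mul hc₀.le]
    ring_nf
  rw [norm_residuals_sq, norm_residuals_sq, Real.div_rpow (by positivity) ht.le,
    Real.div_rpow (by positivity) (by positivity), hpow] at hdecay
  rw [Real.rpow_neg ht.le]
  refine le_of_mul_le_mul_left (hdecay.trans_eq ?_) two_pos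
  ring

end IsWellConditioned

end NesterovFlow

section SmallestEigenvalue

open Matrix

variable {ι : Type*} [Fintype ι] {A : Matrix ι ι ℝ}

theorem abs_dotProduct_mulVec_le (A : Matrix ι ι ℝ) (z : ι → ℝ) :
    |z ⬝ᵥ A *ᵥ z| ≤ √(∑ i, ∑ j, A i j ^ 2) * (z ⬝ᵥ z) := by
  have hz : 0 ≤ z ⬝ᵥ z := Finset.sum_nonneg fun i _ => mul_self_nonneg (z i)
  refine abs_le_of_sq_le_sq ?_ (by positivity)
  rw [mul_pow, Real.sq_sqrt (by positivity)]
  simp only [dotProduct, mulVec, Finset.mul_sum, ← Fintype.sum_prod_type']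
  calc (∑ k : ι × ι, z k.1 * (A k.1 k.2 * z k.2)) ^ 2
      = (∑ k : ι × ι, A k.1 k.2 * (z k.1 * z k.2)) ^ 2 := by simp only [mul_left_comm]
    _ ≤ (∑ k : ι × ι, A k.1 k.2 ^ 2) * ∑ k : ι × ι, (z k.1 * z k.2) ^ 2 :=
        Finset.sum_mul_sq_le_sq_mul_sq _ _ _
    _ = (∑ k : ι × ι, A k.1 k.2 ^ 2) * (∑ i, z i * z i) ^ 2 := by
        rw [sq (∑ i, z i * z i), Fintype.sum_mul_sum (fun i => z i * z i) fun j => z j * z j,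
          ← Fintype.sum_prod_type' fun i j => z i * z i * (z j * z j)]
        simp only [mul_pow, sq (z _)]

variable [DecidableEq ι]

theorem sInf_spectrum_mem [Nonempty ι] (hA : A.IsHermitian) :
    sInf (spectrum ℝ A) ∈ spectrum ℝ A := by
  refine Nonempty.csInf_mem ?_ A.finite_real_spectrum
  rw [hA.spectrum_real_eq_range_eigenvalues]
  exact range_nonempty _

theorem sInf_spectrum_pos [Nonempty ι] (hA : A.PosDef) : 0 < sInf (spectrum ℝ A) := by
  have h := sInf_spectrum_mem hA.isHermitian
  rw [hA.isHermitian.spectrum_real_eq_range_eigenvalues] at h ⊢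
  obtain ⟨i, hi⟩ := h
  exact hi ▸ hA.eigenvalues_pos i

theorem sInf_spectrum_mul_dotProduct_le (hA : A.IsHermitian) (z : ι → ℝ) :
    sInf (spectrum ℝ A) * (z ⬝ᵥ z) ≤ z ⬝ᵥ A *ᵥ z := by
  set l := sInf (spectrum ℝ A)
  have hps : (A - l • (1 : Matrix ι ι ℝ)).PosSemidef := by
    refine posSemidef_iff_isHermitian_and_spectrum_nonneg.2
      ⟨hA.sub (isHermitian_one.smul (star_trivial l)), ?_⟩
    rw [← Algebra.algebraMap_eq_smul_one, ← spectrum.sub_singleton_eq]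
    rintro _ ⟨μ, hμ, _, rfl, rfl⟩
    exact sub_nonneg.2 (csInf_le A.finite_real_spectrum.bddBelow hμ)
  have := hps.dotProduct_mulVec_nonneg z
  rw [star_trivial, sub_mulVec, dotProduct_sub, smul_mulVec, one_mulVec, dotProduct_smul,
    smul_eq_mul] at this
  linarith

theorem sInf_spectrum_le_apply_self (hA : A.IsHermitian) (i : ι) :
    sInf (spectrum ℝ A) ≤ A i i := by
  simpa using sInf_spectrum_mul_dotProduct_le hA (Pi.single i 1)

end SmallestEigenvalue

section Gate

variable {ι E : Type*} [NormedAddCommGroup E] [InnerProductSpace ℝ E]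

theorem gate_nonneg (w x : E) : 0 ≤ gate w x := by
  unfold gate
  split_ifs <;> norm_num

theorem gate_le_one (w x : E) : gate w x ≤ 1 := by
  unfold gate
  split_ifs <;> norm_num

theorem measurable_gate [MeasurableSpace E] [OpensMeasurableSpace E] (x : E) :
    Measurable fun w => gate w x :=
  Measurable.ite (isClosed_le (f := fun _ : E => (0 : ℝ)) (g := fun w => ⟪w, x⟫)
    (by fun_prop) (by fun_prop)).measurableSet measurable_const measurable_const

theorem eventually_gate_eq {z x : E} (hz : ⟪z, x⟫ ≠ 0) : ∀ᶠ w in 𝓝 z, gate w x = gate z x := by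
  have hcont : ContinuousAt (fun w => ⟪w, x⟫) z := by fun_prop
  unfold gate
  rcases hz.lt_or_gt with hneg | hpos
  · filter_upwards [hcont.eventually_lt_const hneg] with w hw
    rw [if_neg hw.not_ge, if_neg hneg.not_ge]
  · filter_upwards [hcont.eventually_const_lt hpos] with w hw
    rw [if_pos hw.le, if_pos hpos.le]

theorem exists_inner_eq_zero_forall_inner_ne_zero [Finite ι] {x : ι → E} (i : ι)
    (hx : ∀ j, j ≠ i → LinearIndependent ℝ ![x i, x j]) :
    ∃ z, ⟪z, x i⟫ = 0 ∧ ∀ j, j ≠ i → ⟪z, x j⟫ ≠ 0 := by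
  by_contra! hcover
  -- A vector space is not a finite union of proper subspaces.
  have hunion : ⋃ j : {j // j ≠ i},
      (((innerSL ℝ (x j)).toLinearMap ∘ₗ (ℝ ∙ x i)ᗮ.subtype).ker : Set (ℝ ∙ x i)ᗮ) = univ := by
    refine eq_univ_of_forall fun z => ?_
    obtain ⟨j, hj, hjz⟩ := hcover z (Submodule.mem_orthogonal_singleton_iff_inner_left.1 z.2)
    exact mem_iUnion.2 ⟨⟨j, hj⟩, by simpa [real_inner_comm] using hjz⟩
  obtain ⟨⟨j, hj⟩, htop⟩ := Subspace.exists_eq_top_of_iUnion_eq_univ hunion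
  have hmem : x j ∈ (ℝ ∙ x i)ᗮᗮ := by
    refine (Submodule.mem_orthogonal' _ _).2 fun u hu => ?_
    have : (⟨u, hu⟩ : (ℝ ∙ x i)ᗮ) ∈ _ := htop ▸ Submodule.mem_top
    simpa using this
  rw [Submodule.orthogonal_orthogonal, Submodule.mem_span_singleton] at hmem
  obtain ⟨c, hc⟩ := hmem
  have := (LinearIndependent.pair_iff.1 (hx j hj) c (-1) (by rw [hc]; simp)).2
  norm_num at this

theorem mem_closure_inner_pos {z x : E} (hx : x ≠ 0) (hz : ⟪z, x⟫ = 0) :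
    z ∈ closure {w | 0 < ⟪w, x⟫} := by
  refine mem_closure_of_tendsto (f := fun ε : ℝ => z + ε • x) (b := 𝓝[>] 0) ?_ ?_
  · have : ContinuousAt (fun ε : ℝ => z + ε • x) 0 := by fun_prop
    simpa using this.mono_left nhdsWithin_le_nhds
  · filter_upwards [self_mem_nhdsWithin] with ε hε
    rw [inner_add_left, real_inner_smul_left, hz, zero_add]
    exact mul_pos hε (real_inner_self_pos.2 hx)

theorem eq_zero_of_dense_sum_gate_smul_eq_zero [Fintype ι] {x : ι → E} (hx₀ : ∀ i, x i ≠ 0)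
    (hx : ∀ i j, i ≠ j → LinearIndependent ℝ ![x i, x j]) {c : ι → ℝ}
    (hc : Dense {w | ∑ i, c i • gate w (x i) • x i = 0}) : c = 0 := by
  ext i
  obtain ⟨z, hzi, hzj⟩ := exists_inner_eq_zero_forall_inner_ne_zero i fun j hj => hx i j hj.symm
  have hconst : ∀ᶠ w in 𝓝 z, ∀ j, j ≠ i → gate w (x j) = gate z (x j) :=
    eventually_all.2 fun j => eventually_imp_distrib_left.2 fun hj => eventually_gate_eq (hzj j hj)
  have hnear : ∀ U : Set E, IsOpen U → z ∈ closure U →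
      ∃ w ∈ U, ∑ j, c j • gate w (x j) • x j = 0 ∧
        ∀ j, j ≠ i → gate w (x j) = gate z (x j) := by
    intro U hU hzU
    have hclosure := closure_minimal (hc.open_subset_closure_inter hU) isClosed_closure hzU
    obtain ⟨w, ⟨hwU, hw⟩, hwz⟩ :=
      ((mem_closure_iff_frequently.1 hclosure).and_eventually hconst).exists
    exact ⟨w, hwU, hw, hwz⟩
  obtain ⟨w, hw, hw₀, hwz⟩ := hnear {w | 0 < ⟪w, x i⟫}
    (isOpen_lt continuous_const (by fun_prop)) (mem_closure_inner_pos (hx₀ i) hzi)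
  obtain ⟨w', hw', hw₀', hwz'⟩ := hnear {w | 0 < ⟪w, -x i⟫}
    (isOpen_lt continuous_const (by fun_prop))
    (mem_closure_inner_pos (neg_ne_zero.2 (hx₀ i)) (by rw [inner_neg_right, hzi, neg_zero]))
  -- Only the `i`-th gate differs on the two sides of the hyperplane orthogonal to `x i`.
  have hjump : c i • x i = 0 :=
    calc c i • x i = c i • gate w (x i) • x i - c i • gate w' (x i) • x i := by
          have hneg : ⟪w', x i⟫ < 0 := by simpa [inner_neg_right] using hw'
          rw [gate, gate, if_pos (le_of_lt hw), if_neg hneg.not_ge, one_smul, zero_smul,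
            smul_zero, sub_zero]
      _ = ∑ j, (c j • gate w (x j) • x j - c j • gate w' (x j) • x j) := by
          refine Eq.symm (Fintype.sum_eq_single i fun j hj => ?_)
          rw [hwz j hj, hwz' j hj, sub_self]
      _ = 0 := by rw [Finset.sum_sub_distrib, hw₀, hw₀', sub_zero]
  exact (smul_eq_zero.1 hjump).resolve_right (hx₀ i)

end Gate

section Gram

open Matrix

variable {ι E : Type*} [NormedAddCommGroup E] [InnerProductSpace ℝ E]

/-- The Gram matrix of the inputs activated by a neuron with weight `w`. Its expectation over a
standard Gaussian `w` is `H^∞`. -/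
noncomputable def gateGram (x : ι → E) (w : E) : Matrix ι ι ℝ := gram ℝ fun i => gate w (x i) • x i

theorem gateGram_apply (x : ι → E) (w : E) (i j : ι) :
    gateGram x w i j = gate w (x i) * gate w (x j) * ⟪x i, x j⟫ := by
  rw [gateGram, gram_apply, real_inner_smul_left, real_inner_smul_right, mul_assoc]

theorem abs_gateGram_le (x : ι → E) (w : E) (i j : ι) :
    |gateGram x w i j| ≤ ‖x i‖ * ‖x j‖ := by
  have hgate : |gate w (x i) * gate w (x j)| ≤ 1 := by
    rw [abs_of_nonneg (mul_nonneg (gate_nonneg _ _) (gate_nonneg _ _))]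
    exact mul_le_one₀ (gate_le_one _ _) (gate_nonneg _ _) (gate_le_one _ _)
  rw [gateGram_apply, abs_mul]
  exact (mul_le_of_le_one_left (abs_nonneg _) hgate).trans (abs_real_inner_le_norm _ _)

theorem dotProduct_gateGram_mulVec [Fintype ι] (x : ι → E) (w : E) (z : ι → ℝ) :
    z ⬝ᵥ gateGram x w *ᵥ z = ‖∑ i, z i • gate w (x i) • x i‖ ^ 2 := by
  rw [← real_inner_self_eq_norm_sq]
  exact star_dotProduct_gram_mulVec _ z z

variable [MeasurableSpace E] [OpensMeasurableSpace E]

theorem measurable_gateGram (x : ι → E) (i j : ι) : Measurable fun w => gateGram x w i j := by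
  simp only [gateGram_apply]
  exact ((measurable_gate _).mul (measurable_gate _)).mul_const _

theorem integrable_gateGram (x : ι → E) (μ : Measure E) [IsFiniteMeasure μ] (i j : ι) :
    Integrable (fun w => gateGram x w i j) μ :=
  .of_bound (measurable_gateGram x i j).aestronglyMeasurable _
    (.of_forall fun w => abs_gateGram_le x w i j)

end Gram

section GramInfty

open Matrix

variable {n p : ℕ} {x : Fin n → EuclideanSpace ℝ (Fin p)}

theorem isOpenPosMeasure_stdGaussian :
    (stdGaussian (EuclideanSpace ℝ (Fin p))).IsOpenPosMeasure := by
  have : (gaussianReal 0 1).IsOpenPosMeasure :=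
    (gaussianReal_absolutelyContinuous' 0 one_ne_zero).isOpenPosMeasure
  rw [← map_pi_eq_stdGaussian]
  exact (PiLp.continuousLinearEquiv 2 ℝ fun _ : Fin p => ℝ).symm.continuous.isOpenPosMeasure_map
    (PiLp.continuousLinearEquiv 2 ℝ fun _ : Fin p => ℝ).symm.surjective

theorem gramInfty_apply (x : Fin n → EuclideanSpace ℝ (Fin p)) (i j : Fin n) :
    gramInfty x i j = ∫ w, gateGram x w i j ∂stdGaussian (EuclideanSpace ℝ (Fin p)) := by
  simp only [gramInfty, of_apply, gateGram_apply, gate]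
  refine integral_congr_ae (.of_forall fun w => ?_)
  by_cases hi : 0 ≤ ⟪w, x i⟫ <;> by_cases hj : 0 ≤ ⟪w, x j⟫ <;> simp [hi, hj]

theorem isHermitian_gramInfty (x : Fin n → EuclideanSpace ℝ (Fin p)) :
    (gramInfty x).IsHermitian := by
  ext i j
  rw [conjTranspose_apply, star_trivial, gramInfty_apply, gramInfty_apply]
  exact integral_congr_ae (.of_forall fun w => (isHermitian_gram ℝ _).apply i j)

theorem integrable_norm_sum_gate_smul_sq (x : Fin n → EuclideanSpace ℝ (Fin p)) (z : Fin n → ℝ) :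
    Integrable (fun w => ‖∑ i, z i • gate w (x i) • x i‖ ^ 2)
      (stdGaussian (EuclideanSpace ℝ (Fin p))) := by
  simp only [← dotProduct_gateGram_mulVec, dotProduct, mulVec]
  exact integrable_finsetSum _ fun i _ => (integrable_finsetSum _ fun j _ =>
    (integrable_gateGram x _ i j).mul_const _).const_mul _

theorem dotProduct_gramInfty_mulVec (x : Fin n → EuclideanSpace ℝ (Fin p)) (z : Fin n → ℝ) :
    z ⬝ᵥ gramInfty x *ᵥ z =
      ∫ w, ‖∑ i, z i • gate w (x i) • x i‖ ^ 2 ∂stdGaussian (EuclideanSpace ℝ (Fin p)) := by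
  have hint : ∀ i j, Integrable (fun w => gateGram x w i j * z j)
      (stdGaussian (EuclideanSpace ℝ (Fin p))) :=
    fun i j => (integrable_gateGram x _ i j).mul_const _
  simp only [← dotProduct_gateGram_mulVec, dotProduct, mulVec, gramInfty_apply]
  rw [integral_finsetSum _ fun i _ => (integrable_finsetSum _ fun j _ => hint i j).const_mul _]
  simp only [integral_const_mul, integral_finsetSum _ fun j _ => hint _ j, integral_mul_const]

theorem posDef_gramInfty (hx₀ : ∀ i, x i ≠ 0)
    (hx : ∀ i j, i ≠ j → LinearIndependent ℝ ![x i, x j]) : (gramInfty x).PosDef := by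
  have := isOpenPosMeasure_stdGaussian (p := p)
  refine PosDef.of_dotProduct_mulVec_pos (isHermitian_gramInfty x) fun z hz => ?_
  rw [star_trivial, dotProduct_gramInfty_mulVec]
  refine (integral_nonneg fun w => sq_nonneg _).lt_of_ne' fun h₀ => hz ?_
  have hae := (integral_eq_zero_iff_of_nonneg (fun w => sq_nonneg _)
    (integrable_norm_sum_gate_smul_sq x z)).1 h₀
  refine eq_zero_of_dense_sum_gate_smul_eq_zero hx₀ hx
    (Measure.dense_of_ae (μ := stdGaussian (EuclideanSpace ℝ (Fin p))) ?_)
  filter_upwards [hae] with w hw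
  exact norm_eq_zero.1 (sq_eq_zero_iff.1 hw)

theorem lambdaZero_pos [NeZero n] (hx₀ : ∀ i, x i ≠ 0)
    (hx : ∀ i j, i ≠ j → LinearIndependent ℝ ![x i, x j]) : 0 < lambdaZero x :=
  sInf_spectrum_pos (posDef_gramInfty hx₀ hx)

theorem neZero_of_lambdaZero_pos (hl : 0 < lambdaZero x) : NeZero n := by
  refine ⟨fun hn => hl.ne' ?_⟩
  subst hn
  rw [lambdaZero, spectrum.of_subsingleton, Real.sInf_empty]

theorem lambdaZero_le_one [NeZero n] (hx : ∀ i, ‖x i‖ ≤ 1) : lambdaZero x ≤ 1 := by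
  refine (sInf_spectrum_le_apply_self (isHermitian_gramInfty x) 0).trans ?_
  have hle : ∀ w, gateGram x w 0 0 ≤ 1 := fun w => (le_abs_self _).trans <|
    (abs_gateGram_le x w 0 0).trans (mul_le_one₀ (hx 0) (norm_nonneg _) (hx 0))
  rw [gramInfty_apply]
  exact (integral_mono (integrable_gateGram x _ 0 0) (integrable_const 1) hle).trans_eq (by simp)

end GramInfty

section EmpiricalGram

open Matrix

variable {n m p : ℕ} (x : Fin n → EuclideanSpace ℝ (Fin p)) {a : Fin m → ℝ}
  (W : Fin m → EuclideanSpace ℝ (Fin p))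

/-- The Gram matrix of the hidden layer with weights `W`, an empirical approximation of `H^∞`. -/
noncomputable def empiricalGram : Matrix (Fin n) (Fin n) ℝ := (m : ℝ)⁻¹ • ∑ r, gateGram x (W r)

/-- The squared Frobenius distance between the empirical Gram matrix and `H^∞`. -/
noncomputable def gramError : ℝ := ∑ i, ∑ j, (empiricalGram x W - gramInfty x) i j ^ 2

theorem norm_jacobian_pattern_adjoint_sq (ha : ∀ r, a r ^ 2 = 1)
    (z : EuclideanSpace ℝ (Fin n)) :
    ‖(jacobian x a (pattern x W)).adjoint z‖ ^ 2 = z ⬝ᵥ empiricalGram x W *ᵥ z := by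
  rw [jacobian_adjoint_apply, PiLp.norm_sq_eq_of_L2, empiricalGram, smul_mulVec, sum_mulVec,
    dotProduct_smul, dotProduct_sum, smul_eq_mul, Finset.mul_sum]
  refine Finset.sum_congr rfl fun r _ => ?_
  have hfactor : ∑ i, (z i * (1 / √(m : ℝ) * a r * pattern x W r i)) • x i =
      (1 / √(m : ℝ) * a r) • ∑ i, z i • gate (W r) (x i) • x i := by
    rw [Finset.smul_sum]
    refine Finset.sum_congr rfl fun i _ => ?_
    rw [smul_smul, smul_smul, pattern]
    ring_nf
  rw [dotProduct_gateGram_mulVec]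
  change ‖∑ i, (z i * (1 / √(m : ℝ) * a r * pattern x W r i)) • x i‖ ^ 2 = _
  rw [hfactor, norm_smul, mul_pow, Real.norm_eq_abs, sq_abs, mul_pow, ha, mul_one, div_pow,
    one_pow, Real.sq_sqrt (Nat.cast_nonneg m), one_div]

variable {x W}

theorem lambdaZero_half_mul_norm_sq_le (hW : gramError x W ≤ (lambdaZero x / 2) ^ 2)
    (ha : ∀ r, a r ^ 2 = 1) (hl : 0 ≤ lambdaZero x) (z : EuclideanSpace ℝ (Fin n)) :
    lambdaZero x / 2 * ‖z‖ ^ 2 ≤ ‖(jacobian x a (pattern x W)).adjoint z‖ ^ 2 := by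
  have hz : ‖z‖ ^ 2 = z ⬝ᵥ z := by
    rw [EuclideanSpace.real_norm_sq_eq]
    simp only [dotProduct, sq]
  have hmin := sInf_spectrum_mul_dotProduct_le (isHermitian_gramInfty x) z
  have herr := calc |z ⬝ᵥ (empiricalGram x W - gramInfty x) *ᵥ z|
      ≤ √(gramError x W) * (z ⬝ᵥ z) := abs_dotProduct_mulVec_le _ _
    _ ≤ lambdaZero x / 2 * (z ⬝ᵥ z) := by
      rw [← hz]
      gcongr
      exact Real.sqrt_le_iff.2 ⟨by positivity, hW⟩
  rw [sub_mulVec, dotProduct_sub] at herr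
  rw [norm_jacobian_pattern_adjoint_sq x W ha, hz]
  rw [← lambdaZero] at hmin
  linarith [neg_le_of_abs_le herr]

end EmpiricalGram

section SecondMoments

variable {Ω ι : Type*} {mΩ : MeasurableSpace Ω} {μ : Measure Ω} [IsProbabilityMeasure μ]

theorem one_sub_le_measureReal_lt {f : Ω → ℝ} {c δ : ℝ} (hf : ∀ ω, 0 ≤ f ω) (hfm : Measurable f)
    (hfi : Integrable f μ) (hc : 0 < c) (h : ∫ ω, f ω ∂μ ≤ c * δ) :
    1 - δ ≤ μ.real {ω | f ω < c} := by
  have hmarkov : μ.real {ω | c ≤ f ω} ≤ δ :=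
    le_of_mul_le_mul_left ((mul_meas_ge_le_integral_of_nonneg (.of_forall hf) hfi c).trans h) hc
  have hcompl : {ω | f ω < c} = {ω | c ≤ f ω}ᶜ := by
    ext ω
    simp
  rw [hcompl, probReal_compl_eq_one_sub (measurableSet_le measurable_const hfm)]
  linarith

theorem measureReal_add_measureReal_sub_one_le_inter (s : Set Ω) {t : Set Ω}
    (ht : MeasurableSet t) : μ.real s + μ.real t - 1 ≤ μ.real (s ∩ t) := by
  linarith [measureReal_union_add_inter (μ := μ) (s := s) ht,
    measureReal_le_one (μ := μ) (s := s ∪ t)]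

variable {f : Ω → ℝ}

theorem memLp_sum_comp_eval [Fintype ι] (hf : MemLp f 2 μ) :
    MemLp (fun ω : ι → Ω => ∑ i, f (ω i)) 2 (Measure.pi fun _ => μ) :=
  memLp_finsetSum _ fun i _ =>
    hf.comp_measurePreserving (measurePreserving_eval (fun _ : ι => μ) i)

theorem integral_sum_comp_eval [Fintype ι] (hf : Integrable f μ) :
    ∫ ω : ι → Ω, ∑ i, f (ω i) ∂(Measure.pi fun _ => μ) = Fintype.card ι * ∫ ω, f ω ∂μ := by
  rw [integral_finsetSum _ fun i _ => integrable_comp_eval (μ := fun _ : ι => μ) hf]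
  simp [integral_comp_eval (μ := fun _ : ι => μ) hf.aestronglyMeasurable]

theorem variance_sum_comp_eval [Fintype ι] (hf : MemLp f 2 μ) :
    Var[fun ω : ι → Ω => ∑ i, f (ω i); Measure.pi fun _ => μ] = Fintype.card ι * Var[f; μ] := by
  have h := variance_sum_pi (μ := fun _ : ι => μ) fun _ : ι => hf
  rw [Finset.sum_const, Finset.card_univ, nsmul_eq_mul] at h
  rw [← h]
  congr 1
  ext ω
  simp

theorem integral_average_sub_sq [Fintype ι] [Nonempty ι] (hf : MemLp f 2 μ) :
    ∫ ω : ι → Ω, ((Fintype.card ι : ℝ)⁻¹ * ∑ i, f (ω i) - ∫ ω, f ω ∂μ) ^ 2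
      ∂(Measure.pi fun _ => μ) = Var[f; μ] / Fintype.card ι := by
  have hmean : ∫ ω : ι → Ω, (Fintype.card ι : ℝ)⁻¹ * ∑ i, f (ω i) ∂(Measure.pi fun _ => μ) =
      ∫ ω, f ω ∂μ := by
    rw [integral_const_mul, integral_sum_comp_eval (hf.integrable one_le_two)]
    field_simp
  have hvar := variance_const_mul (Fintype.card ι : ℝ)⁻¹ (fun ω : ι → Ω => ∑ i, f (ω i))
    (Measure.pi fun _ => μ)
  rw [variance_sum_comp_eval hf, variance_eq_integral
    ((memLp_sum_comp_eval hf).const_mul _).aestronglyMeasurable.aemeasurable, hmean] at hvar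
  rw [hvar]
  field_simp

theorem integral_sum_comp_eval_sq [Fintype ι] (hf : MemLp f 2 μ) (hmean : ∫ ω, f ω ∂μ = 0) :
    ∫ ω : ι → Ω, (∑ i, f (ω i)) ^ 2 ∂(Measure.pi fun _ => μ) =
      Fintype.card ι * ∫ ω, f ω ^ 2 ∂μ := by
  have hsum := integral_sum_comp_eval (ι := ι) (hf.integrable one_le_two)
  rw [hmean, mul_zero] at hsum
  rw [← variance_of_integral_eq_zero (memLp_sum_comp_eval hf).aestronglyMeasurable.aemeasurable
    hsum, variance_sum_comp_eval hf,
    variance_of_integral_eq_zero hf.aestronglyMeasurable.aemeasurable hmean]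

theorem integral_sub_const_sq (hf : MemLp f 2 μ) (c : ℝ) :
    ∫ ω, (f ω - c) ^ 2 ∂μ = ∫ ω, f ω ^ 2 ∂μ - 2 * c * ∫ ω, f ω ∂μ + c ^ 2 := by
  have hlin := (hf.integrable one_le_two).const_mul (2 * c)
  have hexpand : ∀ ω, (f ω - c) ^ 2 = f ω ^ 2 - 2 * c * f ω + c ^ 2 := fun ω => by ring
  have hquad : Integrable (fun ω => f ω ^ 2 - 2 * c * f ω) μ := hf.integrable_sq.sub hlin
  simp only [hexpand]
  rw [integral_add hquad (integrable_const _), integral_sub hf.integrable_sq hlin,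
    integral_const_mul, integral_const, probReal_univ, one_smul]

end SecondMoments

section Initialization

section Gaussian

variable {E : Type*} [NormedAddCommGroup E] [InnerProductSpace ℝ E] [FiniteDimensional ℝ E]
  [MeasurableSpace E] [BorelSpace E] (x : E)

theorem memLp_inner_stdGaussian : MemLp (fun w => ⟪w, x⟫) 2 (stdGaussian E) :=
  (IsGaussian.memLp_dual _ (innerSL ℝ x) 2 (by norm_num)).ae_eq
    (.of_forall fun w => real_inner_comm w x)

theorem integral_inner_sq_stdGaussian : ∫ w, ⟪w, x⟫ ^ 2 ∂stdGaussian E = ‖x‖ ^ 2 := by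
  have h := variance_dual_stdGaussian (innerSL ℝ x)
  rw [variance_of_integral_eq_zero (innerSL ℝ x).continuous.aemeasurable
    (integral_strongDual_stdGaussian _), innerSL_apply_norm] at h
  simpa only [innerSL_apply_apply, real_inner_comm x] using h

theorem map_inner_stdGaussian :
    (stdGaussian E).map (fun w => ⟪w, x⟫) = gaussianReal 0 (‖x‖ ^ 2).toNNReal := by
  have h := IsGaussian.map_eq_gaussianReal (μ := stdGaussian E) (innerSL ℝ x)
  rw [integral_strongDual_stdGaussian, variance_dual_stdGaussian, innerSL_apply_norm] at h
  rw [← h]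
  congr 1
  ext w
  exact real_inner_comm _ _

theorem gaussianPDF_zero_one_le (z : ℝ) : gaussianPDF 0 1 z ≤ ENNReal.ofReal (1 / 2) := by
  refine ENNReal.ofReal_le_ofReal ?_
  have hsqrt : (2 : ℝ) ≤ √(2 * Real.pi * (1 : NNReal)) := by
    refine Real.le_sqrt_of_sq_le ?_
    push_cast
    linarith [Real.pi_gt_three]
  have hexp : Real.exp (-(z - 0) ^ 2 / (2 * (1 : NNReal))) ≤ 1 := by
    refine Real.exp_le_one_iff.2 (div_nonpos_of_nonpos_of_nonneg ?_ (by positivity))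
    linarith [sq_nonneg (z - 0)]
  calc gaussianPDFReal 0 1 z ≤ 2⁻¹ * 1 := by
        rw [gaussianPDFReal]
        gcongr
    _ = 1 / 2 := by norm_num

variable {x}

theorem measureReal_abs_inner_le (hx : ‖x‖ = 1) {R : ℝ} (hR : 0 ≤ R) :
    (stdGaussian E).real {w | |⟪w, x⟫| ≤ R} ≤ R := by
  have hset : {w : E | |⟪w, x⟫| ≤ R} = (fun w => ⟪w, x⟫) ⁻¹' Icc (-R) R := by
    ext w
    simp [abs_le]
  refine ENNReal.toReal_le_of_le_ofReal hR ?_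
  calc stdGaussian E {w | |⟪w, x⟫| ≤ R} = ∫⁻ z in Icc (-R) R, gaussianPDF 0 1 z := by
        rw [hset, ← Measure.map_apply (by fun_prop) measurableSet_Icc, map_inner_stdGaussian, hx,
          one_pow, Real.toNNReal_one, gaussianReal_apply 0 one_ne_zero]
    _ ≤ ∫⁻ _ in Icc (-R) R, ENNReal.ofReal (1 / 2) := lintegral_mono gaussianPDF_zero_one_le
    _ = ENNReal.ofReal R := by
        rw [setLIntegral_const, Real.volume_Icc, ← ENNReal.ofReal_mul (by norm_num)]
        ring_nf

end Gaussian

section Signs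

theorem uniformOn_neg_one_one :
    uniformOn ({-1, 1} : Set ℝ) = (2⁻¹ : ENNReal) • (Measure.dirac (-1) + Measure.dirac 1) := by
  have hdisj : Disjoint ({-1} : Set ℝ) {1} := disjoint_singleton.2 (by norm_num)
  have hcount : Measure.count ({-1, 1} : Set ℝ) = 2 := by
    rw [Measure.count_apply (toFinite _).measurableSet, encard_pair (by norm_num)]
    rfl
  rw [uniformOn, ProbabilityTheory.cond, hcount, ← singleton_union,
    Measure.restrict_union hdisj (measurableSet_singleton _), Measure.restrict_singleton,
    Measure.restrict_singleton, Measure.count_singleton, Measure.count_singleton, one_smul,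
    one_smul]

instance isProbabilityMeasure_uniformOn_neg_one_one :
    IsProbabilityMeasure (uniformOn ({-1, 1} : Set ℝ)) :=
  isProbabilityMeasure_uniformOn (toFinite _) (insert_nonempty _ _)

theorem ae_sq_eq_one_uniformOn_neg_one_one :
    ∀ᵐ b ∂uniformOn ({-1, 1} : Set ℝ), b ^ 2 = 1 := by
  filter_upwards [ae_cond_mem (toFinite _).measurableSet] with b hb
  rcases hb with rfl | rfl <;> norm_num

theorem integral_uniformOn_neg_one_one : ∫ b, b ∂uniformOn ({-1, 1} : Set ℝ) = 0 := by
  rw [uniformOn_neg_one_one, integral_smul_measure, integral_add_measure] <;>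
    simp [integrable_dirac]

end Signs

section Network

variable {m p : ℕ} (v : EuclideanSpace ℝ (Fin p))

instance isProbabilityMeasure_initLaw : IsProbabilityMeasure (initLaw m p) := by
  unfold initLaw
  infer_instance

/-- The joint law of the inner and outer weights of a single neuron at initialization. -/
noncomputable def neuronLaw (p : ℕ) : Measure (EuclideanSpace ℝ (Fin p) × ℝ) :=
  (stdGaussian (EuclideanSpace ℝ (Fin p))).prod (uniformOn {-1, 1})

instance isProbabilityMeasure_neuronLaw : IsProbabilityMeasure (neuronLaw p) := by
  unfold neuronLaw
  infer_instance

theorem measurePreserving_pi_neuronLaw_initLaw : MeasurePreserving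
    (MeasurableEquiv.arrowProdEquivProdArrow (EuclideanSpace ℝ (Fin p)) ℝ (Fin m))
    (Measure.pi fun _ => neuronLaw p) (initLaw m p) :=
  measurePreserving_arrowProdEquivProdArrow _ _ _ (fun _ => stdGaussian _)
    (fun _ => uniformOn {-1, 1})

theorem relu_sq_le (z : ℝ) : relu z ^ 2 ≤ z ^ 2 := by
  rcases max_choice z 0 with h | h <;> rw [relu, h]
  simpa using sq_nonneg z

theorem memLp_mul_relu_neuronLaw :
    MemLp (fun q => q.2 * relu ⟪q.1, v⟫) 2 (neuronLaw p) := by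
  have hmeas : Measurable fun q : EuclideanSpace ℝ (Fin p) × ℝ => q.2 * relu ⟪q.1, v⟫ :=
    measurable_snd.mul (lipschitzWith_relu.continuous.measurable.comp (by fun_prop))
  refine ((memLp_inner_stdGaussian v).comp_fst (uniformOn ({-1, 1} : Set ℝ))).mono
    hmeas.aestronglyMeasurable ?_
  filter_upwards [Measure.quasiMeasurePreserving_snd.ae ae_sq_eq_one_uniformOn_neg_one_one]
    with q hq
  rw [Real.norm_eq_abs, Real.norm_eq_abs, ← sq_le_sq, mul_pow, hq, one_mul]
  exact relu_sq_le _

theorem integral_mul_relu_neuronLaw : ∫ q, q.2 * relu ⟪q.1, v⟫ ∂neuronLaw p = 0 := by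
  simp only [mul_comm _ (relu _)]
  rw [neuronLaw, integral_prod_mul (fun w => relu ⟪w, v⟫) fun b => b,
    integral_uniformOn_neg_one_one, mul_zero]

theorem integral_mul_relu_sq_neuronLaw_le :
    ∫ q, (q.2 * relu ⟪q.1, v⟫) ^ 2 ∂neuronLaw p ≤ ‖v‖ ^ 2 := by
  have hinner := (memLp_inner_stdGaussian v).comp_fst (uniformOn ({-1, 1} : Set ℝ))
  calc ∫ q, (q.2 * relu ⟪q.1, v⟫) ^ 2 ∂neuronLaw p ≤ ∫ q, ⟪q.1, v⟫ ^ 2 ∂neuronLaw p := by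
        refine integral_mono_ae (memLp_mul_relu_neuronLaw v).integrable_sq hinner.integrable_sq ?_
        filter_upwards [Measure.quasiMeasurePreserving_snd.ae ae_sq_eq_one_uniformOn_neg_one_one]
          with q hq
        rw [mul_pow, hq, one_mul]
        exact relu_sq_le _
    _ = ‖v‖ ^ 2 := by
        rw [neuronLaw, integral_fun_fst fun w => ⟪w, v⟫ ^ 2, probReal_univ, one_smul,
          integral_inner_sq_stdGaussian]

theorem network_arrowProdEquivProdArrow (q : Fin m → EuclideanSpace ℝ (Fin p) × ℝ) :
    network (MeasurableEquiv.arrowProdEquivProdArrow _ _ _ q).1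
      (MeasurableEquiv.arrowProdEquivProdArrow _ _ _ q).2 v =
      1 / √(m : ℝ) * ∑ r, (q r).2 * relu ⟪(q r).1, v⟫ := rfl

theorem memLp_network : MemLp (fun z => network z.1 z.2 v) 2 (initLaw m p) := by
  rw [← measurePreserving_pi_neuronLaw_initLaw.map_eq, MeasurableEquiv.memLp_map_measure_iff]
  exact (memLp_sum_comp_eval (memLp_mul_relu_neuronLaw v)).const_mul _

theorem integral_network : ∫ z, network z.1 z.2 v ∂initLaw m p = 0 := by
  rw [← measurePreserving_pi_neuronLaw_initLaw.integral_comp' fun z => network z.1 z.2 v]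
  simp only [network_arrowProdEquivProdArrow]
  rw [integral_const_mul,
    integral_sum_comp_eval ((memLp_mul_relu_neuronLaw v).integrable one_le_two),
    integral_mul_relu_neuronLaw, mul_zero, mul_zero]

theorem integral_network_sq_le : ∫ z, network z.1 z.2 v ^ 2 ∂initLaw m p ≤ ‖v‖ ^ 2 := by
  rw [← measurePreserving_pi_neuronLaw_initLaw.integral_comp' fun z => network z.1 z.2 v ^ 2]
  simp only [network_arrowProdEquivProdArrow, mul_pow]
  rw [integral_const_mul, integral_sum_comp_eval_sq (memLp_mul_relu_neuronLaw v)
    (integral_mul_relu_neuronLaw v), Fintype.card_fin, div_pow, one_pow,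
    Real.sq_sqrt (Nat.cast_nonneg m), ← mul_assoc, one_div]
  exact (mul_le_of_le_one_left (integral_nonneg fun _ => sq_nonneg _)
    (inv_mul_le_one (a := (m : ℝ)))).trans (integral_mul_relu_sq_neuronLaw_le v)

end Network

section Residuals

variable {n m p : ℕ} {x : Fin n → EuclideanSpace ℝ (Fin p)} {y : Fin n → ℝ} {B : ℝ}

theorem measurable_norm_residuals_sq (x : Fin n → EuclideanSpace ℝ (Fin p)) (y : Fin n → ℝ) :
    Measurable fun z : (Fin m → EuclideanSpace ℝ (Fin p)) × (Fin m → ℝ) =>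
      ‖residuals x y z.1 z.2‖ ^ 2 := by
  have hrelu : Measurable relu := lipschitzWith_relu.continuous.measurable
  simp only [norm_residuals_sq, loss, network]
  fun_prop

theorem integrable_norm_residuals_sq (x : Fin n → EuclideanSpace ℝ (Fin p)) (y : Fin n → ℝ) :
    Integrable (fun z => ‖residuals x y z.1 z.2‖ ^ 2) (initLaw m p) := by
  simp only [EuclideanSpace.real_norm_sq_eq, residuals]
  exact integrable_finsetSum _ fun i _ =>
    ((memLp_network (x i)).sub (memLp_const (y i))).integrable_sq

theorem integral_norm_residuals_sq_le (hx : ∀ i, ‖x i‖ ≤ 1) (hy : ∀ i, |y i| ≤ B) :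
    ∫ z, ‖residuals x y z.1 z.2‖ ^ 2 ∂initLaw m p ≤ n * (1 + B ^ 2) := by
  simp only [EuclideanSpace.real_norm_sq_eq, residuals]
  have hint : ∀ i, Integrable (fun z => (network z.1 z.2 (x i) - y i) ^ 2) (initLaw m p) :=
    fun i => ((memLp_network (x i)).sub (memLp_const (y i))).integrable_sq
  rw [integral_finsetSum _ fun i _ => hint i]
  have hterm : ∀ i, ∫ z, (network z.1 z.2 (x i) - y i) ^ 2 ∂initLaw m p ≤ 1 + B ^ 2 := fun i => by
    rw [integral_sub_const_sq (memLp_network (x i)), integral_network, mul_zero, sub_zero]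
    exact add_le_add ((integral_network_sq_le _).trans (pow_le_one₀ (norm_nonneg _) (hx i)))
      (sq_le_sq' (neg_le_of_abs_le (hy i)) (le_of_abs_le (hy i)))
  calc ∑ i, ∫ z, (network z.1 z.2 (x i) - y i) ^ 2 ∂initLaw m p ≤ ∑ _ : Fin n, (1 + B ^ 2) :=
        Finset.sum_le_sum fun i _ => hterm i
    _ = n * (1 + B ^ 2) := by
        rw [Finset.sum_const, Finset.card_univ, Fintype.card_fin, nsmul_eq_mul]

end Residuals

section HiddenLayer

variable {n m p : ℕ} (x : Fin n → EuclideanSpace ℝ (Fin p))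

theorem ae_sq_eq_one_initLaw : ∀ᵐ z ∂initLaw m p, ∀ r, z.2 r ^ 2 = 1 := by
  refine ae_all_iff.2 fun r => Measure.quasiMeasurePreserving_snd.ae ?_
    (p := fun a : Fin m → ℝ => a r ^ 2 = 1)
  exact (measurePreserving_eval (fun _ : Fin m => uniformOn ({-1, 1} : Set ℝ))
    r).quasiMeasurePreserving.ae ae_sq_eq_one_uniformOn_neg_one_one

theorem integral_fst_initLaw (f : (Fin m → EuclideanSpace ℝ (Fin p)) → ℝ) :
    ∫ z, f z.1 ∂initLaw m p = ∫ W, f W ∂(Measure.pi fun _ => stdGaussian _) := by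
  rw [initLaw, integral_fun_fst, probReal_univ, one_smul]

theorem measurable_nearKinkCount (R : ℝ) :
    Measurable fun W : Fin m → EuclideanSpace ℝ (Fin p) => nearKinkCount x W R :=
  Finset.measurable_fun_sum _ fun i _ => Finset.measurable_fun_sum _ fun r _ =>
    Measurable.ite (measurableSet_le (by fun_prop) measurable_const) measurable_const
      measurable_const

theorem nearKinkCount_le (W : Fin m → EuclideanSpace ℝ (Fin p)) (R : ℝ) :
    nearKinkCount x W R ≤ n * m := by
  calc nearKinkCount x W R ≤ ∑ _ : Fin n, ∑ _ : Fin m, (1 : ℝ) :=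
        Finset.sum_le_sum fun i _ => Finset.sum_le_sum fun r _ => by split_ifs <;> norm_num
    _ = n * m := by simp

theorem nearKinkCount_nonneg (W : Fin m → EuclideanSpace ℝ (Fin p)) (R : ℝ) :
    0 ≤ nearKinkCount x W R :=
  Finset.sum_nonneg fun i _ => Finset.sum_nonneg fun r _ => by split_ifs <;> norm_num

theorem integrable_nearKinkCount (R : ℝ)
    (μ : Measure (Fin m → EuclideanSpace ℝ (Fin p))) [IsFiniteMeasure μ] :
    Integrable (fun W => nearKinkCount x W R) μ :=
  .of_bound (measurable_nearKinkCount x R).aestronglyMeasurable (n * m) (.of_forall fun W => by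
    rw [Real.norm_of_nonneg (nearKinkCount_nonneg x W R)]
    exact nearKinkCount_le x W R)

variable {x}

theorem integrable_ite_abs_inner_le (ξ : EuclideanSpace ℝ (Fin p)) (R : ℝ) :
    Integrable (fun w => if |⟪w, ξ⟫| ≤ R then (1 : ℝ) else 0) (stdGaussian _) :=
  (integrable_const (1 : ℝ)).indicator (s := {w | |⟪w, ξ⟫| ≤ R})
    (measurableSet_le (by fun_prop) measurable_const)

theorem integral_ite_abs_inner_le (ξ : EuclideanSpace ℝ (Fin p)) (R : ℝ) :
    ∫ w, (if |⟪w, ξ⟫| ≤ R then (1 : ℝ) else 0) ∂stdGaussian _ =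
      (stdGaussian _).real {w | |⟪w, ξ⟫| ≤ R} :=
  integral_indicator_one (s := {w | |⟪w, ξ⟫| ≤ R})
    (measurableSet_le (by fun_prop) measurable_const)

theorem integral_nearKinkCount_le (hx : ∀ i, ‖x i‖ = 1) {R : ℝ} (hR : 0 ≤ R) :
    ∫ W, nearKinkCount x W R ∂(Measure.pi fun _ : Fin m => stdGaussian _) ≤ n * (m * R) := by
  have hint : ∀ i (r : Fin m), Integrable (fun W : Fin m → EuclideanSpace ℝ (Fin p) =>
      if |⟪W r, x i⟫| ≤ R then (1 : ℝ) else 0) (Measure.pi fun _ => stdGaussian _) := fun i r =>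
    (integrable_comp_eval (μ := fun _ : Fin m => stdGaussian (EuclideanSpace ℝ (Fin p))) (i := r)
      (integrable_ite_abs_inner_le (x i) R) :)
  have hterm : ∀ i, ∫ W : Fin m → EuclideanSpace ℝ (Fin p),
      ∑ r, (if |⟪W r, x i⟫| ≤ R then (1 : ℝ) else 0) ∂(Measure.pi fun _ => stdGaussian _) ≤
        m * R := fun i => by
    rw [integral_sum_comp_eval (integrable_ite_abs_inner_le (x i) R), Fintype.card_fin,
      integral_ite_abs_inner_le]
    gcongr
    exact measureReal_abs_inner_le (hx i) hR
  simp only [nearKinkCount]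
  rw [integral_finsetSum _ fun i _ => integrable_finsetSum _ fun r _ => hint i r]
  calc _ ≤ ∑ _ : Fin n, m * R := Finset.sum_le_sum fun i _ => hterm i
    _ = n * (m * R) := by rw [Finset.sum_const, Finset.card_univ, Fintype.card_fin, nsmul_eq_mul]

theorem memLp_gateGram (x : Fin n → EuclideanSpace ℝ (Fin p)) (i j : Fin n) :
    MemLp (fun w => gateGram x w i j) 2 (stdGaussian _) :=
  .of_bound (measurable_gateGram x i j).aestronglyMeasurable _
    (.of_forall fun w => abs_gateGram_le x w i j)

theorem variance_gateGram_le (hx : ∀ i, ‖x i‖ ≤ 1) (i j : Fin n) :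
    Var[fun w => gateGram x w i j; stdGaussian _] ≤ 1 := by
  refine (variance_le_sq_of_bounded (a := -1) (b := 1) (.of_forall fun w => ?_)
    (measurable_gateGram x i j).aemeasurable).trans_eq (by norm_num)
  exact abs_le.1 ((abs_gateGram_le x w i j).trans
    (mul_le_one₀ (hx i) (norm_nonneg _) (hx j)))

theorem empiricalGram_sub_gramInfty_apply (W : Fin m → EuclideanSpace ℝ (Fin p)) (i j : Fin n) :
    (empiricalGram x W - gramInfty x) i j =
      (Fintype.card (Fin m) : ℝ)⁻¹ * ∑ r, gateGram x (W r) i j -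
        ∫ w, gateGram x w i j ∂stdGaussian _ := by
  rw [Matrix.sub_apply, empiricalGram, Matrix.smul_apply, Matrix.sum_apply, gramInfty_apply,
    Fintype.card_fin, smul_eq_mul]

theorem gramError_nonneg (W : Fin m → EuclideanSpace ℝ (Fin p)) : 0 ≤ gramError x W :=
  Finset.sum_nonneg fun _ _ => Finset.sum_nonneg fun _ _ => sq_nonneg _

theorem measurable_gramError (x : Fin n → EuclideanSpace ℝ (Fin p)) :
    Measurable fun W : Fin m → EuclideanSpace ℝ (Fin p) => gramError x W := by
  have hgate := measurable_gateGram x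
  simp only [gramError, empiricalGram_sub_gramInfty_apply]
  fun_prop

theorem integrable_empiricalGram_sub_gramInfty_sq (x : Fin n → EuclideanSpace ℝ (Fin p))
    (i j : Fin n) :
    Integrable (fun W : Fin m → _ => (empiricalGram x W - gramInfty x) i j ^ 2)
      (Measure.pi fun _ => stdGaussian _) := by
  simp only [empiricalGram_sub_gramInfty_apply]
  exact (((memLp_sum_comp_eval (memLp_gateGram x i j)).const_mul _).sub
    (memLp_const _)).integrable_sq

theorem integrable_gramError (x : Fin n → EuclideanSpace ℝ (Fin p)) :
    Integrable (fun W : Fin m → _ => gramError x W) (Measure.pi fun _ => stdGaussian _) :=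
  integrable_finsetSum _ fun i _ => integrable_finsetSum _ fun j _ =>
    integrable_empiricalGram_sub_gramInfty_sq x i j

theorem integral_gramError_le [NeZero m] (hx : ∀ i, ‖x i‖ ≤ 1) :
    ∫ W, gramError x W ∂(Measure.pi fun _ : Fin m => stdGaussian _) ≤ n ^ 2 / m := by
  have hint := integrable_empiricalGram_sub_gramInfty_sq (m := m) x
  have hterm : ∀ i j, ∫ W, (empiricalGram x W - gramInfty x) i j ^ 2
      ∂(Measure.pi fun _ : Fin m => stdGaussian _) ≤ 1 / m := fun i j => by
    simp only [empiricalGram_sub_gramInfty_apply]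
    rw [integral_average_sub_sq (memLp_gateGram x i j), Fintype.card_fin]
    gcongr
    exact variance_gateGram_le hx i j
  simp only [gramError]
  rw [integral_finsetSum _ fun i _ => integrable_finsetSum _ fun j _ => hint i j]
  calc ∑ i, ∫ W, ∑ j, (empiricalGram x W - gramInfty x) i j ^ 2
        ∂(Measure.pi fun _ : Fin m => stdGaussian _)
      ≤ ∑ _ : Fin n, ∑ _ : Fin n, 1 / (m : ℝ) := Finset.sum_le_sum fun i _ => by
        rw [integral_finsetSum _ fun j _ => hint i j]
        exact Finset.sum_le_sum fun j _ => hterm i j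
    _ = n ^ 2 / m := by
        simp only [Finset.sum_const, Finset.card_univ, Fintype.card_fin, nsmul_eq_mul]
        ring

end HiddenLayer

end Initialization

section HighProbability

variable {n m p : ℕ} {x : Fin n → EuclideanSpace ℝ (Fin p)} {y : Fin n → ℝ} {B δ R ε : ℝ}

theorem one_sub_le_measureReal_norm_residuals_sq_lt [NeZero n] (hx : ∀ i, ‖x i‖ ≤ 1)
    (hy : ∀ i, |y i| ≤ B) (hδ : 0 < δ) :
    1 - δ ≤ (initLaw m p).real {z | ‖residuals x y z.1 z.2‖ ^ 2 < n * (1 + B ^ 2) / δ} := by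
  have hn : (0 : ℝ) < n := Nat.cast_pos.2 (NeZero.pos n)
  refine one_sub_le_measureReal_lt (fun z => sq_nonneg _) (measurable_norm_residuals_sq x y)
    (integrable_norm_residuals_sq x y) (by positivity) ?_
  rw [div_mul_cancel₀ _ hδ.ne']
  exact integral_norm_residuals_sq_le hx hy

theorem one_sub_le_measureReal_gramError_lt [NeZero m] (hx : ∀ i, ‖x i‖ ≤ 1) (hδ : 0 < δ)
    (hε : 0 < ε) (hm : n ^ 2 / (δ * ε) ≤ m) :
    1 - δ ≤ (initLaw m p).real {z | gramError x z.1 < ε} := by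
  have hm₀ : (0 : ℝ) < m := Nat.cast_pos.2 (NeZero.pos m)
  refine one_sub_le_measureReal_lt (fun z => gramError_nonneg z.1)
    ((measurable_gramError x).comp measurable_fst) ((integrable_gramError x).comp_fst _) hε ?_
  rw [integral_fst_initLaw]
  refine (integral_gramError_le hx).trans ?_
  rw [div_le_iff₀ (by positivity)] at hm ⊢
  linarith

theorem one_sub_le_measureReal_nearKinkCount_lt [NeZero n] [NeZero m] (hx : ∀ i, ‖x i‖ = 1)
    (hδ : 0 < δ) (hR : 0 < R) :
    1 - δ ≤ (initLaw m p).real {z | nearKinkCount x z.1 R < n * (m * R) / δ} := by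
  have hn : (0 : ℝ) < n := Nat.cast_pos.2 (NeZero.pos n)
  have hm : (0 : ℝ) < m := Nat.cast_pos.2 (NeZero.pos m)
  refine one_sub_le_measureReal_lt (fun z => nearKinkCount_nonneg x z.1 R)
    ((measurable_nearKinkCount x R).comp measurable_fst)
    ((integrable_nearKinkCount x R _).comp_fst _) (by positivity) ?_
  rw [div_mul_cancel₀ _ hδ.ne', integral_fst_initLaw fun W => nearKinkCount x W R]
  exact integral_nearKinkCount_le hx hR.le

theorem one_sub_le_measureReal_inter_inter {Ω : Type*} [MeasurableSpace Ω] {μ : Measure Ω}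
    [IsProbabilityMeasure μ] {s₁ s₂ s₃ : Set Ω} (h₂ : MeasurableSet s₂) (h₃ : MeasurableSet s₃)
    (hs₁ : 1 - δ / 3 ≤ μ.real s₁) (hs₂ : 1 - δ / 3 ≤ μ.real s₂) (hs₃ : 1 - δ / 3 ≤ μ.real s₃) :
    1 - δ ≤ μ.real (s₁ ∩ s₂ ∩ s₃) := by
  have h₁₂ := measureReal_add_measureReal_sub_one_le_inter (μ := μ) s₁ h₂
  have h₁₂₃ := measureReal_add_measureReal_sub_one_le_inter (μ := μ) (s₁ ∩ s₂) h₃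
  linarith

/-- The event that the signs are `±1`, the initial residuals are of order `√(n / δ)`, the Gram
matrix of the hidden layer is close to `H^∞`, and few units are close to their kink. The three
bounds come from Markov's inequality, each with failure probability `δ / 3`. -/
def goodInits (m : ℕ) (x : Fin n → EuclideanSpace ℝ (Fin p)) (y : Fin n → ℝ) (B δ : ℝ) :
    Set ((Fin m → EuclideanSpace ℝ (Fin p)) × (Fin m → ℝ)) :=
  {z | ∀ r, z.2 r ^ 2 = 1} ∩ ({z | ‖residuals x y z.1 z.2‖ ^ 2 < n * (1 + B ^ 2) / (δ / 3)} ∩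
    {z | gramError x z.1 < (lambdaZero x / 2) ^ 2} ∩
    {z | nearKinkCount x z.1 (lambdaZero x * δ / (216 * n)) <
      n * (m * (lambdaZero x * δ / (216 * n))) / (δ / 3)})

theorem measurableSet_goodInits : MeasurableSet (goodInits m x y B δ) := by
  refine .inter ?_ ((MeasurableSet.inter ?_ ?_).inter ?_)
  · simp only [ofPred_forall]
    exact .iInter fun r => measurableSet_eq_fun (by fun_prop) measurable_const
  · exact measurableSet_lt (measurable_norm_residuals_sq x y) measurable_const
  · exact measurableSet_lt ((measurable_gramError x).comp measurable_fst) measurable_const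
  · exact measurableSet_lt ((measurable_nearKinkCount x _).comp measurable_fst) measurable_const

theorem ofReal_one_sub_le_initLaw_goodInits (hx : ∀ i, ‖x i‖ = 1) (hy : ∀ i, |y i| ≤ B)
    (hδ : 0 < δ) (hl : 0 < lambdaZero x) (hm : 12 * (n ^ 2 / (δ * lambdaZero x ^ 2)) ≤ m) :
    ENNReal.ofReal (1 - δ) ≤ initLaw m p (goodInits m x y B δ) := by
  have := neZero_of_lambdaZero_pos hl
  have hn₀ : (0 : ℝ) < n := Nat.cast_pos.2 (NeZero.pos n)
  have hm₀ : (0 : ℝ) < m := lt_of_lt_of_le (by positivity) hm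
  have : NeZero m := ⟨Nat.cast_ne_zero.1 hm₀.ne'⟩
  have hres := one_sub_le_measureReal_norm_residuals_sq_lt (m := m) (δ := δ / 3)
    (fun i => (hx i).le) hy (by positivity)
  have hgram : 1 - δ / 3 ≤ (initLaw m p).real {z | gramError x z.1 < (lambdaZero x / 2) ^ 2} := by
    refine one_sub_le_measureReal_gramError_lt (fun i => (hx i).le) (by positivity)
      (by positivity) (le_of_eq_of_le ?_ hm)
    field_simp
    norm_num
  have hkink := one_sub_le_measureReal_nearKinkCount_lt (m := m) (δ := δ / 3)
    (R := lambdaZero x * δ / (216 * n)) hx (by positivity) (by positivity)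
  refine le_of_le_of_eq ?_ (Eq.symm (Measure.measure_inter_eq_of_ae ae_sq_eq_one_initLaw))
  refine ENNReal.ofReal_le_of_le_toReal
    (one_sub_le_measureReal_inter_inter ?_ ?_ hres hgram hkink)
  · exact measurableSet_lt ((measurable_gramError x).comp measurable_fst) measurable_const
  · exact measurableSet_lt ((measurable_nearKinkCount x _).comp measurable_fst) measurable_const

theorem isWellConditioned_of_mem_goodInits [NeZero n] [NeZero m]
    {W : Fin m → EuclideanSpace ℝ (Fin p)} {a : Fin m → ℝ} (h : (W, a) ∈ goodInits m x y B δ)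
    (hδ : 0 < δ) (hl : 0 ≤ lambdaZero x) :
    IsWellConditioned x a W (lambdaZero x / 2) (lambdaZero x * δ / (216 * n)) := by
  obtain ⟨ha, ⟨-, hgram⟩, hkink⟩ := h
  refine ⟨lambdaZero_half_mul_norm_sq_le (le_of_lt hgram) ha hl, ?_⟩
  have hn₀ : (0 : ℝ) < n := Nat.cast_pos.2 (NeZero.pos n)
  have hm₀ : (0 : ℝ) < m := Nat.cast_pos.2 (NeZero.pos m)
  rw [div_le_iff₀ hm₀]
  refine (le_of_lt hkink).trans_eq ?_
  field_simp
  ring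

/-- The factor `K` of the width condition; the first summand keeps the displacement of the neurons
below `λ₀ δ / (216 n)`, the second one makes the Gram matrix concentrate. -/
noncomputable def widthConstant (α γ B : ℝ) : ℝ :=
  12 * (1 + B ^ 2) * (216 * ((1 + √2 / (α / 2 - 2)) * (3 * (1 + γ + α)) ^ 2)) ^ 2 + 12

theorem widthConstant_pos (α γ B : ℝ) : 0 < widthConstant α γ B := by
  unfold widthConstant
  positivity

theorem displacementRadius_lt {α γ l u : ℝ} (hδ : 0 < δ) (hl : 0 < l) (hn : 0 < n)
    (hu : u ^ 2 ≤ n * (1 + B ^ 2) / (δ / 3))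
    (hm : widthConstant α γ B * (n ^ 4 / (δ ^ 3 * l ^ 4)) ≤ m) :
    displacementRadius n m α γ (l / 2) u < l * δ / (216 * n) := by
  have hm₀ : (0 : ℝ) < m :=
    lt_of_lt_of_le (mul_pos (widthConstant_pos α γ B) (by positivity)) hm
  set D := (1 + √2 / (α / 2 - 2)) * (3 * (1 + γ + α)) ^ 2 with hD
  have hsq : displacementRadius n m α γ (l / 2) u ^ 2 = n / m * u ^ 2 * (2 * D / l) ^ 2 := by
    rw [displacementRadius, mul_pow, mul_pow, mul_pow, Real.sq_sqrt (by positivity), hD]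
    field_simp
  refine lt_of_pow_lt_pow_left₀ 2 (by positivity) ?_
  have hm' : 12 * (1 + B ^ 2) * (216 * D) ^ 2 * (n ^ 4 / (δ ^ 3 * l ^ 4)) < m := by
    refine lt_of_lt_of_le (mul_lt_mul_of_pos_right ?_ (by positivity)) hm
    rw [widthConstant]
    linarith
  calc displacementRadius n m α γ (l / 2) u ^ 2 = n / m * u ^ 2 * (2 * D / l) ^ 2 := hsq
    _ ≤ n / m * (n * (1 + B ^ 2) / (δ / 3)) * (2 * D / l) ^ 2 := by gcongr
    _ = 12 * (1 + B ^ 2) * (216 * D) ^ 2 * (n ^ 4 / (δ ^ 3 * l ^ 4)) / m *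
        (l * δ / (216 * n)) ^ 2 := by
      field_simp
      ring
    _ < 1 * (l * δ / (216 * n)) ^ 2 := by
      gcongr
      rwa [div_lt_one hm₀]
    _ = (l * δ / (216 * n)) ^ 2 := one_mul _

theorem twelve_mul_sq_div_le_width {α γ l : ℝ} (hn : 0 < n) (hδ : 0 < δ) (hδ₁ : δ ≤ 1) (hl : 0 < l)
    (hl₁ : l ≤ 1) (hm : widthConstant α γ B * (n ^ 4 / (δ ^ 3 * l ^ 4)) ≤ m) :
    12 * (n ^ 2 / (δ * l ^ 2)) ≤ m := by
  have hn₁ : (1 : ℝ) ≤ n := Nat.one_le_cast.2 hn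
  calc 12 * (n ^ 2 / (δ * l ^ 2)) ≤ 12 * (n ^ 4 / (δ ^ 3 * l ^ 4)) := by
        gcongr 12 * (?_ / (?_ * ?_))
        · exact pow_le_pow_right₀ hn₁ (by norm_num)
        · exact pow_le_of_le_one hδ.le hδ₁ (by norm_num)
        · exact pow_le_pow_of_le_one hl.le hl₁ (by norm_num)
    _ ≤ widthConstant α γ B * (n ^ 4 / (δ ^ 3 * l ^ 4)) := by
        gcongr
        rw [widthConstant]
        exact le_add_of_nonneg_left (by positivity)
    _ ≤ m := hm

theorem natPow_div_le_rpow_div {α l : ℝ} (hα : 4 ≤ α) (hn : 0 < n) (hδ : 0 < δ) (hδ₁ : δ ≤ 1)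
    (hl : 0 < l) (hl₁ : l ≤ 1) :
    (n ^ 4 / (δ ^ 3 * l ^ 4) : ℝ) ≤
      n ^ (5 * α / 2 - 4) / (δ ^ (3 * α / 2 - 3) * l ^ (3 * α / 2 - 2)) := by
  have hn₁ : (1 : ℝ) ≤ n := Nat.one_le_cast.2 hn
  rw [← Real.rpow_natCast, ← Real.rpow_natCast, ← Real.rpow_natCast]
  gcongr ?_ / (?_ * ?_)
  · exact Real.rpow_le_rpow_of_exponent_le hn₁ (by push_cast; linarith)
  · exact Real.rpow_le_rpow_of_exponent_ge hδ hδ₁ (by push_cast; linarith)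
  · exact Real.rpow_le_rpow_of_exponent_ge hl hl₁ (by push_cast; linarith)

theorem mainTheorem2_general {α γ : ℝ} (hα : 4 < α) (hαγ : α ≤ 2 * γ / 3) :
    ∃ C : ℝ, 0 < C ∧ ∀ B : ℝ, ∃ K : ℝ, 0 < K ∧
      ∀ (n p m : ℕ) (x : Fin n → EuclideanSpace ℝ (Fin p)) (y : Fin n → ℝ) (δ : ℝ),
        (∀ i, ‖x i‖ = 1) → 0 < lambdaZero x → (∀ i, |y i| ≤ B) → 0 < δ → δ ≤ 1 →
        K * (n ^ 4 / (δ ^ 3 * lambdaZero x ^ 4)) ≤ (m : ℝ) →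
        ∃ G : Set ((Fin m → EuclideanSpace ℝ (Fin p)) × (Fin m → ℝ)),
          MeasurableSet G ∧ ENNReal.ofReal (1 - δ) ≤ initLaw m p G ∧
          ∀ W₀ a, (W₀, a) ∈ G →
            ∀ W V : ℝ → Fin m → EuclideanSpace ℝ (Fin p), IsNesterovFlow γ x y a W₀ W V →
              ∀ t : ℝ, 0 < t →
                loss x y (W t) a ≤
                  C / (lambdaZero x / 2) ^ (α / 2) * t ^ (-α) * loss x y (W 0) a := by
  refine ⟨2 * (3 * (1 + γ + α)) ^ α, ?_, fun B => ⟨widthConstant α γ B, widthConstant_pos α γ B,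
    fun n p m x y δ hx hl hy hδ hδ₁ hm => ?_⟩⟩
  · have : 0 < 1 + γ + α := by linarith
    positivity
  have := neZero_of_lambdaZero_pos hl
  have hn : 0 < n := NeZero.pos n
  have hl₁ : lambdaZero x ≤ 1 := lambdaZero_le_one fun i => (hx i).le
  have hm₁ := twelve_mul_sq_div_le_width hn hδ hδ₁ hl hl₁ hm
  refine ⟨goodInits m x y B δ, measurableSet_goodInits,
    ofReal_one_sub_le_initLaw_goodInits hx hy hδ hl hm₁, fun W₀ a hWa W V hflow t ht => ?_⟩
  have : NeZero m := ⟨Nat.cast_ne_zero.1 (lt_of_lt_of_le (by positivity) hm₁).ne'⟩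
  have hradius := displacementRadius_lt hδ hl hn hWa.2.1.1.le hm
  exact (isWellConditioned_of_mem_goodInits hWa hδ hl.le).loss_le (by positivity)
    (fun i => (hx i).le) (fun r => (sq_le_one_iff_abs_le_one _).1 (hWa.1 r).le) hflow hα hαγ
    (by positivity) hradius ht

end HighProbability

end

theorem mainTheorem2 (α γ : ℝ) (hγ : 6 < γ) (hα : 4 < α) (hαγ : α ≤ 2 * γ / 3) :
    ∃ C : ℝ, 0 < C ∧ ∀ B : ℝ, ∃ K : ℝ, 0 < K ∧
      ∀ (n p m : ℕ) (x : Fin n → EuclideanSpace ℝ (Fin p)) (y : Fin n → ℝ) (δ : ℝ),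
        1 ≤ n → (∀ i, ‖x i‖ = 1) → (∀ i j, i ≠ j → LinearIndependent ℝ ![x i, x j]) →
        (∀ i, |y i| < B) → 0 < δ → δ < 1 →
        K * ((n : ℝ) ^ (5 * α / 2 - 4) /
          (δ ^ (3 * α / 2 - 3) * lambdaZero x ^ (3 * α / 2 - 2))) ≤ (m : ℝ) →
        ∃ G : Set ((Fin m → EuclideanSpace ℝ (Fin p)) × (Fin m → ℝ)),
          MeasurableSet G ∧ ENNReal.ofReal (1 - δ) ≤ initLaw m p G ∧
          ∀ W₀ a, (W₀, a) ∈ G →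
            ∀ W V : ℝ → Fin m → EuclideanSpace ℝ (Fin p), IsNesterovFlow γ x y a W₀ W V →
              ∀ t : ℝ, 0 < t →
                loss x y (W t) a ≤
                  C / (lambdaZero x / 2) ^ (α / 2) * t ^ (-α) * loss x y (W 0) a := by
  obtain ⟨C, hC, hmain⟩ := mainTheorem2_general hα hαγ
  refine ⟨C, hC, fun B => (hmain B).imp fun K ⟨hK, h⟩ => ⟨hK, ?_⟩⟩
  intro n p m x y δ hn hx hpar hy hδ hδ₁ hm
  have : NeZero n := .of_pos hn
  have hl : 0 < lambdaZero x :=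
    lambdaZero_pos (fun i => norm_ne_zero_iff.1 ((hx i).trans_ne one_ne_zero)) hpar
  have hwidth := natPow_div_le_rpow_div hα.le hn hδ hδ₁.le hl (lambdaZero_le_one fun i => (hx i).le)
  exact h n p m x y δ hx hl (fun i => (hy i).le) hδ hδ₁.le
    ((mul_le_mul_of_nonneg_left hwidth hK.le).trans hm)
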